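/- Let $d\ge 1$, let $\mathbf T^d=\mathbf R^d/\mathbf Z^d$, and let $A=(A_1,\dots,A_d)\in[H^s(\mathbf T^d)]^d$ with $s>\frac{3d}{2}-1$. Here $A$ may be complex-valued; if $d\ge 3$, assume that the mean value $\int_{\mathbf T^d}A(x)\,dx$ is real (which is automatic for a real magnetic potential). Then there exist constants $C>0$, $\beta>0$, $\rho_0\in\mathbf R$ and a vector $e\in\mathbf R^d$ such that for all real $\rho\ge\rho_0$ and all $u\in H^2(\mathbf T^d)$ $$\|(D+k+A(x))^2u\|_{L_2(\mathbf T^d)}\ \ge\ C\bigl(|\rho|\,\|u\|_{L_2(\mathbf T^d)}+\|u\|_{H^1(\mathbf T^d)}\bigr),\qquad k=(\beta+i\rho)e\in\mathbf C^d .$$ Here $D=-i\nabla$ and $(D+k+A)^2u=\sum_{j=1}^d(D_j+k_j+A_j)(D_j+k_j+A_j)u$ in the sense of periodic distributions. If $s\ge 1$ (in particular whenever $d\ge 2$), this distribution lies in $L_2(\mathbf T^d)$ for every $u\in H^2(\mathbf T^d)$; in the remaining case $d=1$, $\frac12<s<1$, the left-hand side is understood as $+\infty$ when it does not. -/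

import Mathlib

open MeasureTheory

noncomputable section

/-- `|n|² = n₁² + ⋯ + n_d²` for an integer vector `n`. -/
def freqSq {d : ℕ} (n : Fin d → ℤ) : ℝ := ∑ j, (n j : ℝ) ^ 2

/-- The normalized Lebesgue (Haar) measure on the torus `𝕋^d = ℝ^d / ℤ^d`. -/
abbrev torusMeasure (d : ℕ) : Measure (UnitAddTorus (Fin d)) :=
  Measure.pi fun _ => (AddCircle.haarAddCircle : Measure UnitAddCircle)

/-- `f ∈ H^s(𝕋^d)`, for real `s ≥ 0`: `f` is square integrable and
`∑ₙ (1 + |n|²)^s |f̂(n)|² < ∞`. -/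
def MemSobolev {d : ℕ} (s : ℝ) (f : UnitAddTorus (Fin d) → ℂ) : Prop :=
  MemLp f 2 (torusMeasure d) ∧
    Summable fun n : Fin d → ℤ => (1 + freqSq n) ^ s * ‖UnitAddTorus.mFourierCoeff f n‖ ^ 2

/-- The norm of `H^s(𝕋^d)`, to be used for `f` with `MemSobolev s f`. -/
def sobolevNorm {d : ℕ} (s : ℝ) (f : UnitAddTorus (Fin d) → ℂ) : ℝ :=
  Real.sqrt (∑' n : Fin d → ℤ, (1 + freqSq n) ^ s * ‖UnitAddTorus.mFourierCoeff f n‖ ^ 2)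

/-- The norm of `L₂(𝕋^d)`, to be used for square integrable `f`. -/
def l2Norm {d : ℕ} (f : UnitAddTorus (Fin d) → ℂ) : ℝ :=
  (eLpNorm f 2 (torusMeasure d)).toReal

/-- The `n`-th Fourier coefficient of the periodic distribution `(D_j + k_j + A_j) f`, where
`D_j = -i ∂/∂x_j` and `f`, `A_j` are square integrable (so that `A_j f` is integrable); `D_j`
multiplies the `n`-th Fourier coefficient by `2π n_j`. -/
def momentumCoeff {d : ℕ} (A : Fin d → UnitAddTorus (Fin d) → ℂ) (k : Fin d → ℂ) (j : Fin d)
    (f : UnitAddTorus (Fin d) → ℂ) (n : Fin d → ℤ) : ℂ :=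
  (2 * (Real.pi : ℂ) * (n j : ℂ) + k j) * UnitAddTorus.mFourierCoeff f n +
    UnitAddTorus.mFourierCoeff (fun x => A j x * f x) n

/-- `w ∈ L₂(𝕋^d)` and `(D + k + A)² u = w` in the sense of periodic distributions, that is
`∑_j (D_j + k_j + A_j) v_j = w` with `v_j = (D_j + k_j + A_j) u ∈ L₂(𝕋^d)`. Periodic
distributions are equal when their Fourier coefficients are. -/
def IsMagneticSquare {d : ℕ} (A : Fin d → UnitAddTorus (Fin d) → ℂ) (k : Fin d → ℂ)
    (u w : UnitAddTorus (Fin d) → ℂ) : Prop :=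
  MemLp w 2 (torusMeasure d) ∧
    ∃ v : Fin d → UnitAddTorus (Fin d) → ℂ,
      (∀ j, MemLp (v j) 2 (torusMeasure d)) ∧
      (∀ j n, UnitAddTorus.mFourierCoeff (v j) n = momentumCoeff A k j u n) ∧
      ∀ n, UnitAddTorus.mFourierCoeff w n = ∑ j, momentumCoeff A k j (v j) n

end

noncomputable section

/-! On the Fourier side the operator is `Σ ζ_j² + 2 Σ X_j ζ_j + B`. Here `ζ_j(n) = 2πn_j + b_j +
iρe_j` with the mean of `A_j` absorbed into `b_j`, `X_j` is convolution with the coefficients of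
`A_j` without the mean, and `B` is bounded. Since `‖X_j ζ_j u‖` can be of order `ρ‖u‖`, the same
order as the available lower bound for `|Σ ζ_j²|`, it is not a small perturbation and has to be
removed by conjugation.

For `d ≥ 2` take `e = (1, N, …, N^(d-1))`. As `e` is an integer vector, `β` can be chosen so that
`|Σ ζ_j²| ≥ ρ/2` for all `n` and large `ρ`, with a constant independent of `N`
(`exists_shift_le_norm_sum_symb_sq`). Frequencies with `|2πn|/ρ` large are elliptic: there `|Σ ζ_j²|
≥ ρ²`. The remaining scaled frequencies lie in a compact set. Near a point `y` of it `ζ_j ≈ ρ z_j`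
with `z = y + ie`, and one conjugates by `exp Ψ`, `Ψ` being convolution with `ψ(m) = z·a(m) / (2π
z·m)`. The commutator of `Σ ζ_j²` with `exp Ψ` then cancels the leading part of `2 Σ X_j ζ_j` on
every mode `m` used in `ψ` (`conjugated_lower_bound`, `exists_conjugation`). A Lipschitz cutoff and
compactness glue the local bounds together (`exists_nhds_localBound`, `exists_estimate`).

The division needs `z·m ≠ 0`, which `e·m ≠ 0` guarantees. A nonzero integer `m` with `e·m = 0`
satisfies `|m| ≥ N` (`le_norm_of_geometric_orthogonal`), while `|z|` is of order `N^(d-1)`. So the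
uncancelled modes cost at most a multiple of `Σ_{|m| ≥ N} |m|^(d-1) |a(m)|`, which is small for
large `N` (`exists_direction`). Finiteness of the full sum is what `s > d/2 + (d-1)` gives.

For `d = 1` the operator is the square of `ζ + X` with `|ζ| ≥ ρ` and `X` bounded, so two first order
bounds suffice. -/

/-- The space `ℓ²(ι)` of square summable complex sequences. -/
abbrev SeqL2 (ι : Type*) := lp (fun _ : ι => ℂ) 2

namespace SeqL2

/-- Bounded operators on `ℓ²(ι)`. -/
abbrev Op (ι : Type*) := SeqL2 ι →L[ℂ] SeqL2 ι

instance (ι : Type*) : AddCommGroup (SeqL2 ι) := inferInstance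
instance (ι : Type*) : AddCommMonoid (SeqL2 ι) := inferInstance
instance (ι : Type*) : NormedAddCommGroup (SeqL2 ι) := inferInstance
instance (ι : Type*) : SeminormedAddCommGroup (SeqL2 ι) := inferInstance
instance (ι : Type*) : NormedSpace ℂ (SeqL2 ι) := inferInstance
instance (ι : Type*) : Module ℂ (SeqL2 ι) := inferInstance
instance (ι : Type*) : TopologicalSpace (SeqL2 ι) := inferInstance
instance (ι : Type*) : NormedRing (Op ι) := inferInstance
instance (ι : Type*) : Ring (Op ι) := inferInstance
instance (ι : Type*) : NormedAlgebra ℂ (Op ι) := inferInstance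
instance (ι : Type*) : AddCommGroup (Op ι) := inferInstance
instance (ι : Type*) : NormedSpace ℂ (Op ι) := inferInstance
instance (ι : Type*) : Module ℂ (Op ι) := inferInstance
instance (ι : Type*) : Mul (Op ι) := inferInstance
instance (ι : Type*) : Add (Op ι) := inferInstance
instance (ι : Type*) : Sub (Op ι) := inferInstance
instance (ι : Type*) : Norm (Op ι) := inferInstance
instance (ι : Type*) : TopologicalSpace (Op ι) := inferInstance
instance (ι : Type*) : CompleteSpace (Op ι) := inferInstance

/-! ### Entrywise comparison in `ℓ²` -/

section Pointwise

variable {ι : Type*}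

theorem norm_ofReal_smul (C : ℝ) (g : SeqL2 ι) : ‖(C : ℂ) • g‖ = |C| * ‖g‖ := by
  rw [norm_smul, Complex.norm_real, Real.norm_eq_abs]

theorem norm_ofReal_smul_apply (C : ℝ) (g : SeqL2 ι) (n : ι) :
    ‖((C : ℂ) • g) n‖ = |C| * ‖g n‖ := by
  rw [lp.coeFn_smul, Pi.smul_apply, norm_smul, Complex.norm_real, Real.norm_eq_abs]

theorem norm_le_mul {f g : SeqL2 ι} {C : ℝ} (hC : 0 ≤ C) (h : ∀ n, ‖f n‖ ≤ C * ‖g n‖) :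
    ‖f‖ ≤ C * ‖g‖ := by
  have : ‖f‖ ≤ ‖(C : ℂ) • g‖ := by
    refine lp.norm_mono (by simp) fun n => ?_
    rw [norm_ofReal_smul_apply, abs_of_nonneg hC]
    exact h n
  rwa [norm_ofReal_smul, abs_of_nonneg hC] at this

/-- The sequence of absolute values. -/
def abs (f : SeqL2 ι) : SeqL2 ι :=
  ⟨fun n => (‖f n‖ : ℂ), (lp.memℓp f).mono' (fun n => by simp)⟩

theorem abs_apply (f : SeqL2 ι) (n : ι) : abs f n = (‖f n‖ : ℂ) := rfl

theorem norm_abs (f : SeqL2 ι) : ‖abs f‖ = ‖f‖ := by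
  apply le_antisymm
  · simpa using norm_le_mul (f := abs f) (g := f) (C := 1) zero_le_one (by simp [abs_apply])
  · simpa using norm_le_mul (f := f) (g := abs f) (C := 1) zero_le_one (by simp [abs_apply])

theorem norm_le_add {f g h : SeqL2 ι} (H : ∀ n, ‖f n‖ ≤ ‖g n‖ + ‖h n‖) : ‖f‖ ≤ ‖g‖ + ‖h‖ := by
  have : ‖f‖ ≤ ‖abs g + abs h‖ := by
    refine lp.norm_mono (by simp) fun n => ?_
    rw [lp.coeFn_add, Pi.add_apply, abs_apply, abs_apply, ← Complex.ofReal_add, Complex.norm_real,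
      Real.norm_of_nonneg (by positivity)]
    exact H n
  exact this.trans ((norm_add_le _ _).trans (by rw [norm_abs, norm_abs]))

theorem norm_le_mul_add_mul {f g h : SeqL2 ι} {a b : ℝ} (ha : 0 ≤ a) (hb : 0 ≤ b)
    (H : ∀ n, ‖f n‖ ≤ a * ‖g n‖ + b * ‖h n‖) : ‖f‖ ≤ a * ‖g‖ + b * ‖h‖ := by
  have := norm_le_add (f := f) (g := (a : ℂ) • g) (h := (b : ℂ) • h) (fun n => by
    rw [norm_ofReal_smul_apply, norm_ofReal_smul_apply, abs_of_nonneg ha, abs_of_nonneg hb]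
    exact H n)
  rwa [norm_ofReal_smul, norm_ofReal_smul, abs_of_nonneg ha, abs_of_nonneg hb] at this

/-- Existence of a square summable sequence with prescribed entries. -/
theorem exists_of_le {g : SeqL2 ι} {φ : ι → ℂ} {C : ℝ} (h : ∀ n, ‖φ n‖ ≤ C * ‖g n‖) :
    ∃ f : SeqL2 ι, ∀ n, f n = φ n :=
  ⟨⟨φ, (lp.memℓp ((C : ℂ) • g)).mono' (fun n => by
    rw [norm_ofReal_smul_apply]
    exact (h n).trans (mul_le_mul_of_nonneg_right (le_abs_self C) (norm_nonneg _)))⟩,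
    fun _ => rfl⟩

theorem norm_sq_eq (f : SeqL2 ι) : ‖f‖ ^ 2 = ∑' n, ‖f n‖ ^ 2 := by
  have := lp.norm_rpow_eq_tsum (p := 2) (by simp) f
  simpa using this

theorem summable_norm_sq (f : SeqL2 ι) : Summable fun n => ‖f n‖ ^ 2 := by
  have := (lp.memℓp f).summable (by simp)
  simpa using this

theorem exists_of_summable {φ : ι → ℂ} (h : Summable fun n => ‖φ n‖ ^ 2) :
    ∃ f : SeqL2 ι, ∀ n, f n = φ n :=
  ⟨⟨φ, memℓp_gen (by simpa using h)⟩, fun _ => rfl⟩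

/-- Evaluation at `n` as a continuous functional. -/
def eval (n : ι) : SeqL2 ι →L[ℂ] ℂ := lp.evalCLM ℂ (fun _ : ι => ℂ) 2 n

theorem eval_apply (n : ι) (f : SeqL2 ι) : eval n f = f n := rfl

end Pointwise

/-! ### Translations and convolution operators -/

section Shift

variable {ι : Type*} [AddCommGroup ι]

theorem memlp_shift (f : SeqL2 ι) (m : ι) : Memℓp (fun n => f (n - m)) 2 := by
  refine memℓp_gen ?_
  have := (summable_norm_sq f).comp_injective (Equiv.subRight m).injective
  simpa [Function.comp_def] using this

theorem memlp_weightedShift {c : ι → ℂ} {C : ℝ} (hc : ∀ n, ‖c n‖ ≤ C) (m : ι) (f : SeqL2 ι) :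
    Memℓp (fun n => c n * f (n - m)) 2 := by
  let g : SeqL2 ι := ⟨fun n => f (n - m), memlp_shift f m⟩
  refine (lp.memℓp ((C : ℂ) • g)).mono' fun n => ?_
  rw [norm_mul, norm_ofReal_smul_apply]
  exact mul_le_mul_of_nonneg_right ((hc n).trans (le_abs_self C)) (norm_nonneg _)

theorem norm_weightedShift_apply_le {c : ι → ℂ} {C : ℝ} (hc : ∀ n, ‖c n‖ ≤ C) (m : ι)
    (f : SeqL2 ι) :
    ‖(⟨fun n => c n * f (n - m), memlp_weightedShift hc m f⟩ : SeqL2 ι)‖ ≤ C * ‖f‖ := by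
  have hC : 0 ≤ C := (norm_nonneg _).trans (hc 0)
  let g : SeqL2 ι := ⟨fun n => f (n - m), memlp_shift f m⟩
  have hg : ‖g‖ = ‖f‖ := by
    rw [← sq_eq_sq₀ (norm_nonneg _) (norm_nonneg _), norm_sq_eq, norm_sq_eq]
    exact (Equiv.subRight m).tsum_eq (fun n => ‖f n‖ ^ 2)
  rw [← hg]
  refine norm_le_mul hC fun n => ?_
  exact (norm_mul_le _ _).trans (mul_le_mul_of_nonneg_right (hc n) (norm_nonneg _))

/-- The linear map underlying `weightedShift`. -/
def weightedShiftLinear (c : ι → ℂ) (C : ℝ) (hc : ∀ n, ‖c n‖ ≤ C) (m : ι) :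
    SeqL2 ι →ₗ[ℂ] SeqL2 ι where
  toFun f := ⟨fun n => c n * f (n - m), memlp_weightedShift hc m f⟩
  map_add' f g := lp.ext (funext fun n => mul_add (c n) (f (n - m)) (g (n - m)))
  map_smul' r f := lp.ext (funext fun n => mul_left_comm (c n) r (f (n - m)))

/-- `f ↦ (c(n) f(n - m))ₙ` for `|c| ≤ C`. -/
def weightedShift (c : ι → ℂ) (C : ℝ) (hc : ∀ n, ‖c n‖ ≤ C) (m : ι) :
    Op ι :=
  (weightedShiftLinear c C hc m).mkContinuous C (norm_weightedShift_apply_le hc m)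

theorem weightedShift_apply (c : ι → ℂ) (C : ℝ) (hc : ∀ n, ‖c n‖ ≤ C) (m : ι) (f : SeqL2 ι)
    (n : ι) : weightedShift c C hc m f n = c n * f (n - m) := rfl

theorem norm_weightedShift_le (c : ι → ℂ) (C : ℝ) (hc : ∀ n, ‖c n‖ ≤ C) (m : ι) :
    ‖weightedShift c C hc m‖ ≤ C :=
  LinearMap.mkContinuous_norm_le _ ((norm_nonneg _).trans (hc 0)) _

/-- Translation by `m`. -/
def shift (m : ι) : Op ι := weightedShift (fun _ => 1) 1 (by simp) m

theorem shift_apply (m : ι) (f : SeqL2 ι) (n : ι) : shift m f n = f (n - m) := by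
  simp [shift, weightedShift_apply]

theorem norm_shift_le (m : ι) : ‖shift m‖ ≤ 1 := norm_weightedShift_le _ _ _ _

theorem shift_commute (m l : ι) : Commute (shift m) (shift l) := by
  refine ContinuousLinearMap.ext fun f => lp.ext (funext fun n => ?_)
  simp only [mul_apply_eq_comp, shift_apply]
  abel_nf

/-- Convolution with a summable sequence. -/
def conv (a : ι → ℂ) : Op ι := ∑' m, a m • shift m

theorem norm_smul_shift_le (a : ι → ℂ) (m : ι) : ‖a m • (shift m : Op ι)‖ ≤ ‖a m‖ := by
  rw [norm_smul]
  exact mul_le_of_le_one_right (norm_nonneg _) (norm_shift_le m)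

variable {a b : ι → ℂ}

theorem summable_smul_shift (ha : Summable fun m => ‖a m‖) :
    Summable fun m => a m • (shift m : Op ι) :=
  Summable.of_norm_bounded ha (norm_smul_shift_le a)

theorem hasSum_conv (ha : Summable fun m => ‖a m‖) :
    HasSum (fun m => a m • (shift m : Op ι)) (conv a) :=
  (summable_smul_shift ha).hasSum

theorem norm_conv_le (ha : Summable fun m => ‖a m‖) : ‖conv a‖ ≤ ∑' m, ‖a m‖ :=
  tsum_of_norm_bounded ha.hasSum (norm_smul_shift_le a)

theorem hasSum_conv_apply (ha : Summable fun m => ‖a m‖) (f : SeqL2 ι) (n : ι) :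
    HasSum (fun m => a m * f (n - m)) (conv a f n) := by
  have h1 := (hasSum_conv ha).mapL (ContinuousLinearMap.apply ℂ (SeqL2 ι) f)
  have h2 := h1.mapL (eval n)
  simpa [eval_apply, shift_apply] using h2

theorem commute_conv_of_commute_shift (a : ι → ℂ)
    {X : Op ι} (h : ∀ m, Commute X (shift m)) : Commute X (conv a) :=
  Commute.tsum_right _ fun m => (h m).smul_right _

theorem conv_commute_conv (a b : ι → ℂ) :
    Commute (conv a) (conv b) :=
  commute_conv_of_commute_shift b fun m =>
    (commute_conv_of_commute_shift a fun l => shift_commute m l).symm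

theorem conv_add (ha : Summable fun m => ‖a m‖) (hb : Summable fun m => ‖b m‖) :
    conv (fun m => a m + b m) = conv a + conv b := by
  refine HasSum.tsum_eq ?_
  simpa [add_smul] using (hasSum_conv ha).add (hasSum_conv hb)

/-- Convolution is symmetric. -/
theorem conv_apply_comm {f g : SeqL2 ι} (hf : Summable fun m => ‖f m‖)
    (hg : Summable fun m => ‖g m‖) : conv f g = conv g f := by
  refine lp.ext (funext fun n => ?_)
  refine (hasSum_conv_apply hf g n).unique ?_
  have := hasSum_conv_apply hg f n
  rw [← (Equiv.subLeft n).hasSum_iff] at this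
  simpa [Function.comp_def, mul_comm] using this

end Shift

/-! ### Commutators with unbounded multiplication operators -/

section Commutator

variable {ι : Type*}

/-- `Y` is the commutator of multiplication by the (possibly unbounded) function `δ` with `X`. -/
def HasCommutator (δ : ι → ℂ) (X Y : Op ι) : Prop :=
  ∀ f f' : SeqL2 ι, (∀ n, f' n = δ n * f n) → ∀ n, δ n * X f n = X f' n + Y f n

namespace HasCommutator

variable {δ : ι → ℂ} {X X' Y Y' : Op ι}

theorem smul (c : ℂ) (h : HasCommutator δ X Y) : HasCommutator δ (c • X) (c • Y) :=
  fun f f' hf n => by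
  have := h f f' hf n
  simp only [_root_.smul_apply, lp.coeFn_smul, Pi.smul_apply, smul_eq_mul] at *
  linear_combination c * this

theorem mul (h : HasCommutator δ X Y) (h' : HasCommutator δ X' Y') :
    HasCommutator δ (X * X') (Y * X' + X * Y') := fun f f' hf n => by
  have := h (X' f) (X' f' + Y' f) (fun n => by
    rw [lp.coeFn_add, Pi.add_apply, h' f f' hf n]) n
  simp only [mul_apply_eq_comp, _root_.add_apply, map_add, lp.coeFn_add,
    Pi.add_apply] at *
  linear_combination this

theorem one : HasCommutator δ (1 : Op ι) 0 := fun f f' hf n => by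
  simp [hf n]

theorem of_hasSum {κ : Type*} {x y : κ → Op ι}
    (h : ∀ k, HasCommutator δ (x k) (y k)) (hx : HasSum x X) (hy : HasSum y Y) :
    HasCommutator δ X Y := fun f f' hf n => by
  have key : ∀ {z : κ → Op ι} {Z}, HasSum z Z → ∀ g,
      HasSum (fun k => z k g n) (Z g n) := fun {z Z} hz g => by
    have h2 := (hz.mapL (ContinuousLinearMap.apply ℂ (SeqL2 ι) g)).mapL (eval n)
    simpa [eval_apply] using h2
  refine ((key hx f).mul_left (δ n)).unique ?_
  have := (key hx f').add (key hy f)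
  simpa only [h _ f f' hf n] using this

theorem pow_succ (h : HasCommutator δ X Y) (hXY : Commute X Y) (k : ℕ) :
    HasCommutator δ (X ^ (k + 1)) (((k : ℂ) + 1) • (Y * X ^ k)) := by
  induction k with
  | zero => simpa using h
  | succ k ih =>
    have := ih.mul h
    rw [← _root_.pow_succ] at this
    convert this using 1
    rw [smul_mul_assoc, mul_assoc, ← _root_.pow_succ, ← (hXY.pow_left (k + 1)).eq.symm]
    push_cast
    rw [add_smul _ (1 : ℂ), one_smul]

/-- Since `Y` commutes with `X`, the commutator with `X ^ (k + 1)` is `(k + 1) Y X ^ k`, and the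
exponential series can be differentiated term by term. -/
theorem exp (h : HasCommutator δ X Y) (hXY : Commute X Y) :
    HasCommutator δ (NormedSpace.exp X) (Y * NormedSpace.exp X) := by
  have hX := NormedSpace.exp_series_hasSum_exp' (𝕂 := ℂ) X
  -- The constant term has zero commutator, so the series of commutators is the exponential series
  -- shifted by one index.
  let y : ℕ → Op ι :=
    fun k => Nat.casesOn k 0 (fun k => ((k.factorial : ℂ)⁻¹) • (Y * X ^ k))
  refine of_hasSum (y := y) (fun k => ?_) hX ?_
  · cases k with
    | zero => simpa [y] using one
    | succ k =>
      have := (h.pow_succ hXY k).smul (((k + 1).factorial : ℂ)⁻¹)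
      convert this using 1
      rw [smul_smul]
      change (_ : ℂ) • _ = _
      congr 1
      rw [Nat.factorial_succ]
      push_cast
      have : (k : ℂ) + 1 ≠ 0 := by exact_mod_cast Nat.succ_ne_zero k
      field_simp
  · rw [← hasSum_nat_add_iff' 1]
    simpa [y] using hX.mul_left Y

end HasCommutator

variable [AddCommGroup ι]

theorem hasCommutator_shift {δ : ι → ℂ} {ℓ : ι → ℂ} (hδ : ∀ n m, δ n = δ (n - m) + ℓ m) (m : ι) :
    HasCommutator δ (shift m) (ℓ m • shift m) := fun f f' hf n => by
  simp only [_root_.smul_apply, lp.coeFn_smul, Pi.smul_apply, smul_eq_mul,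
    shift_apply, hf]
  rw [hδ n m]
  ring

theorem hasCommutator_conv {δ : ι → ℂ} {ℓ a : ι → ℂ} (hδ : ∀ n m, δ n = δ (n - m) + ℓ m)
    (ha : Summable fun m => ‖a m‖) (ha' : Summable fun m => ‖ℓ m * a m‖) :
    HasCommutator δ (conv a) (conv fun m => ℓ m * a m) := by
  refine HasCommutator.of_hasSum (fun m => (hasCommutator_shift hδ m).smul (a m))
    (hasSum_conv ha) ?_
  simpa only [smul_smul, mul_comm] using hasSum_conv ha'

/-- Multiplication by a bounded function. -/
def diag (c : ι → ℂ) (C : ℝ) (hc : ∀ n, ‖c n‖ ≤ C) : Op ι :=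
  weightedShift c C hc 0

theorem diag_apply (c : ι → ℂ) (C : ℝ) (hc : ∀ n, ‖c n‖ ≤ C) (f : SeqL2 ι) (n : ι) :
    diag c C hc f n = c n * f n := by simp [diag, weightedShift_apply]

theorem norm_diag_le (c : ι → ℂ) (C : ℝ) (hc : ∀ n, ‖c n‖ ≤ C) : ‖diag c C hc‖ ≤ C :=
  norm_weightedShift_le _ _ _ _

/-- The commutator with translation by `m` is again a weighted translation, with weight `c(n) - c(n
- m)`. A Lipschitz bound on `c` therefore costs one moment of `a`. -/
theorem norm_commutator_diag_conv_le {a : ι → ℂ} {c : ι → ℂ} {C : ℝ} (hc : ∀ n, ‖c n‖ ≤ C)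
    {L : ι → ℝ} (hL : ∀ n m, ‖c n - c (n - m)‖ ≤ L m) (ha : Summable fun m => ‖a m‖)
    (haL : Summable fun m => ‖a m‖ * L m) :
    ‖diag c C hc * conv a - conv a * diag c C hc‖ ≤ ∑' m, ‖a m‖ * L m := by
  have h := ((hasSum_conv ha).mul_left (diag c C hc)).sub
    ((hasSum_conv ha).mul_right (diag c C hc))
  rw [← h.tsum_eq]
  refine tsum_of_norm_bounded haL.hasSum fun m => ?_
  have : diag c C hc * (a m • shift m) - (a m • shift m) * diag c C hc
      = a m • weightedShift (fun n => c n - c (n - m)) (L m) (fun n => hL n m) m := by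
    refine ContinuousLinearMap.ext fun f => lp.ext (funext fun n => ?_)
    simp only [_root_.sub_apply, mul_apply_eq_comp, lp.coeFn_sub,
      Pi.sub_apply, _root_.smul_apply, lp.coeFn_smul, Pi.smul_apply, smul_eq_mul,
      shift_apply, diag_apply, weightedShift_apply]
    ring
  rw [this, norm_smul]
  exact mul_le_mul_of_nonneg_left (norm_weightedShift_le _ _ _ _) (norm_nonneg _)

end Commutator

/-! ### Conjugation by an exponential -/

section Conjugation

variable {ι : Type*} {J : Type*} [Fintype J]

theorem norm_le_norm_exp_neg_mul (Ψ : Op ι) (f : SeqL2 ι) :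
    ‖f‖ ≤ ‖NormedSpace.exp (-Ψ)‖ * ‖NormedSpace.exp Ψ f‖ := by
  have h : NormedSpace.exp (-Ψ) * NormedSpace.exp Ψ = 1 := by
    let _ : NormedAlgebra ℚ (Op ι) := NormedAlgebra.restrictScalars ℚ ℂ (Op ι)
    have := NormedSpace.exp_add_of_commute (Commute.neg_left (Commute.refl Ψ))
    rw [← this, neg_add_cancel, NormedSpace.exp_zero]
  have h2 : f = NormedSpace.exp (-Ψ) (NormedSpace.exp Ψ f) := by
    rw [← mul_apply_eq_comp, h]; rfl
  conv_lhs => rw [h2]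
  exact ContinuousLinearMap.le_opNorm _ _

/-- The second order commutator of `Σ ζ_j²` with `exp Ψ`. -/
def expSecond (Ψ : Op ι) (Ψ₁ Ψ₂ : J → Op ι) : Op ι :=
  ∑ j, (Ψ₂ j * NormedSpace.exp Ψ + Ψ₁ j * (Ψ₁ j * NormedSpace.exp Ψ))

/-- Moving `ζ_j` past `exp Ψ` twice, each time with `[ζ_j, exp Ψ] = Ψ₁ exp Ψ`, produces a first
order term `2 Ψ₁ exp Ψ ζ_j` and a bounded remainder. The first order term is the one meant to match
`2 X_j ζ_j`. -/
theorem conjugated_square_apply {ζ : J → ι → ℂ} {Ψ : Op ι} {Ψ₁ Ψ₂ : J → Op ι}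
    (h₁ : ∀ j, HasCommutator (ζ j) Ψ (Ψ₁ j)) (h₂ : ∀ j, HasCommutator (ζ j) (Ψ₁ j) (Ψ₂ j))
    (hc : ∀ j, Commute Ψ (Ψ₁ j)) {f : SeqL2 ι} {f₁ f₂ : J → SeqL2 ι}
    (hf₁ : ∀ j n, f₁ j n = ζ j n * f n) (hf₂ : ∀ j n, f₂ j n = ζ j n * f₁ j n) (n : ι) :
    (∑ j, ζ j n ^ 2) * NormedSpace.exp Ψ f n =
      (NormedSpace.exp Ψ (∑ j, f₂ j) + (2 : ℂ) • ∑ j, (Ψ₁ j * NormedSpace.exp Ψ) (f₁ j) +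
        expSecond Ψ Ψ₁ Ψ₂ f) n := by
  have key : ∀ j, ζ j n ^ 2 * NormedSpace.exp Ψ f n =
      NormedSpace.exp Ψ (f₂ j) n + 2 * (Ψ₁ j * NormedSpace.exp Ψ) (f₁ j) n +
        (Ψ₂ j * NormedSpace.exp Ψ + Ψ₁ j * (Ψ₁ j * NormedSpace.exp Ψ)) f n := by
    intro j
    have e₁ := (h₁ j).exp (hc j)
    have e₂ := (h₂ j).mul e₁
    have a₁ := e₁ f (f₁ j) (hf₁ j) n
    have a₂ := e₁ (f₁ j) (f₂ j) (hf₂ j) n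
    have a₃ := e₂ f (f₁ j) (hf₁ j) n
    linear_combination ζ j n * a₁ + a₂ + a₃
  rw [Finset.sum_mul, Finset.sum_congr rfl fun j _ => key j]
  simp only [Finset.sum_add_distrib, lp.coeFn_add, Pi.add_apply, lp.coeFn_smul, Pi.smul_apply,
    smul_eq_mul, map_sum, lp.coeFn_sum, Finset.sum_apply, expSecond, sum_apply, _root_.add_apply,
    Finset.mul_sum]

/-- Writing `ζ_j f = ρ z_j f + r_j` makes the difference of `2 Σ X_j ζ_j` and `2 Σ Ψ₁ ζ_j` equal to
`2ρ Σ z_j (X_j - Ψ₁)` plus a term in `r_j`. By `hz` only the tail `XR` survives in the factor of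
`ρ`. That term is kept in the form `ρ ‖exp Ψ f‖`, free of the norms of `exp (±Ψ)`, because `Ψ`
depends on how small the tail has been made. -/
theorem conjugated_lower_bound {ζ : J → ι → ℂ} {Ψ : Op ι} {Ψ₁ Ψ₂ X XF XR : J → Op ι}
    (h₁ : ∀ j, HasCommutator (ζ j) Ψ (Ψ₁ j)) (h₂ : ∀ j, HasCommutator (ζ j) (Ψ₁ j) (Ψ₂ j))
    (hc : ∀ j, Commute Ψ (Ψ₁ j)) (hcX : ∀ j, Commute Ψ (X j)) (hX : ∀ j, X j = XF j + XR j)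
    {z : J → ℂ} (hz : ∑ j, z j • XF j = ∑ j, z j • Ψ₁ j) {c ρ t : ℝ} (hρ : 0 ≤ ρ) (hc0 : 0 ≤ c)
    (ht : 0 ≤ t)
    (hlow : ∀ n, c * ρ ≤ ‖∑ j, ζ j n ^ 2‖) {f : SeqL2 ι} {f₁ f₂ : J → SeqL2 ι}
    (hf₁ : ∀ j n, f₁ j n = ζ j n * f n) (hf₂ : ∀ j n, f₂ j n = ζ j n * f₁ j n)
    (hr : ∀ j n, ‖(ζ j n - ρ * z j) * f n‖ ≤ t * ‖f n‖) :
    c * ρ * ‖NormedSpace.exp Ψ f‖ ≤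
      ‖NormedSpace.exp Ψ‖ * ‖∑ j, f₂ j + (2 : ℂ) • ∑ j, X j (f₁ j)‖ +
      2 * ρ * (∑ j, ‖z j‖ * ‖XR j‖) * ‖NormedSpace.exp Ψ f‖ +
      (2 * (∑ j, ‖X j - Ψ₁ j‖ * ‖NormedSpace.exp Ψ‖) * t + ‖expSecond Ψ Ψ₁ Ψ₂‖) * ‖f‖ := by
  set G := NormedSpace.exp Ψ with hG
  have hGX : ∀ j, G * X j = X j * G := fun j => ((hcX j).exp_left).eq
  let r : J → SeqL2 ι := fun j => f₁ j - ((ρ : ℂ) * z j) • f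
  have hrn : ∀ j, ‖r j‖ ≤ t * ‖f‖ := fun j => norm_le_mul ht fun n => by
    have : r j n = (ζ j n - ρ * z j) * f n := by
      simp only [r, lp.coeFn_sub, Pi.sub_apply, lp.coeFn_smul, Pi.smul_apply, smul_eq_mul, hf₁]
      ring
    rw [this]
    exact hr j n
  have hsum : ∑ j, z j • (X j - Ψ₁ j) = ∑ j, z j • XR j := by
    simp only [hX, add_sub_right_comm, smul_add, smul_sub, Finset.sum_add_distrib,
      Finset.sum_sub_distrib, hz]
    simp
  have hk : G (∑ j, f₂ j) + (2 : ℂ) • ∑ j, (Ψ₁ j * G) (f₁ j) + expSecond Ψ Ψ₁ Ψ₂ f =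
      G (∑ j, f₂ j + (2 : ℂ) • ∑ j, X j (f₁ j)) -
        ((2 : ℂ) * ρ) • ∑ j, z j • XR j (G f) -
        (2 : ℂ) • ∑ j, ((X j - Ψ₁ j) * G) (r j) + expSecond Ψ Ψ₁ Ψ₂ f := by
    have e1 : ∑ j, z j • XR j (G f) = ∑ j, z j • (X j - Ψ₁ j) (G f) := by
      have := congrArg (fun T : Op ι => T (G f)) hsum
      simpa only [sum_apply, _root_.smul_apply] using this.symm
    have e2 : ∀ j, G (X j (f₁ j)) = X j (G (f₁ j)) := fun j => by
      rw [← mul_apply_eq_comp, hGX, mul_apply_eq_comp]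
    have e3 : ∀ j, ((X j - Ψ₁ j) * G) (r j) =
        X j (G (f₁ j)) - (Ψ₁ j * G) (f₁ j) - (ρ : ℂ) • z j • (X j - Ψ₁ j) (G f) := fun j => by
      simp only [r, map_sub, map_smul, mul_apply_eq_comp, _root_.sub_apply, mul_smul]
    rw [e1, map_add, map_smul, map_sum G, map_sum G]
    simp only [e2, e3, Finset.sum_sub_distrib, ← Finset.smul_sum, smul_sub, mul_smul]
    abel
  have hlow' : c * ρ * ‖G f‖ ≤
      ‖G (∑ j, f₂ j) + (2 : ℂ) • ∑ j, (Ψ₁ j * G) (f₁ j) + expSecond Ψ Ψ₁ Ψ₂ f‖ := by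
    have := norm_le_mul (f := ((c * ρ : ℝ) : ℂ) • G f)
      (g := G (∑ j, f₂ j) + (2 : ℂ) • ∑ j, (Ψ₁ j * G) (f₁ j) + expSecond Ψ Ψ₁ Ψ₂ f)
      zero_le_one (fun n => by
        rw [norm_ofReal_smul_apply, ← conjugated_square_apply h₁ h₂ hc hf₁ hf₂ n, norm_mul,
          one_mul, abs_of_nonneg (by positivity)]
        exact mul_le_mul_of_nonneg_right (hlow n) (norm_nonneg _))
    rwa [norm_ofReal_smul, one_mul, abs_of_nonneg (by positivity)] at this
  refine hlow'.trans ?_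
  rw [hk]
  have b1 : ‖G (∑ j, f₂ j + (2 : ℂ) • ∑ j, X j (f₁ j))‖ ≤
      ‖G‖ * ‖∑ j, f₂ j + (2 : ℂ) • ∑ j, X j (f₁ j)‖ := ContinuousLinearMap.le_opNorm _ _
  have b2 : ‖((2 : ℂ) * ρ) • ∑ j, z j • XR j (G f)‖ ≤
      2 * ρ * (∑ j, ‖z j‖ * ‖XR j‖) * ‖G f‖ := by
    rw [norm_smul, norm_mul, Complex.norm_real, Real.norm_of_nonneg hρ, Complex.norm_ofNat,
      mul_assoc _ _ ‖G f‖, Finset.sum_mul]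
    refine mul_le_mul_of_nonneg_left (norm_sum_le_of_le _ fun j _ => ?_) (by positivity)
    rw [norm_smul, mul_assoc]
    exact mul_le_mul_of_nonneg_left (ContinuousLinearMap.le_opNorm _ _) (norm_nonneg _)
  have b3 : ‖(2 : ℂ) • ∑ j, ((X j - Ψ₁ j) * G) (r j)‖ ≤
      2 * (∑ j, ‖X j - Ψ₁ j‖ * ‖G‖) * t * ‖f‖ := by
    rw [norm_smul, Complex.norm_ofNat, mul_assoc 2, mul_assoc 2, Finset.sum_mul, Finset.sum_mul]
    refine mul_le_mul_of_nonneg_left (norm_sum_le_of_le _ fun j _ => ?_) (by positivity)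
    rw [mul_assoc _ t]
    exact (ContinuousLinearMap.le_opNorm _ _).trans
      (mul_le_mul (norm_mul_le _ _) (hrn j) (norm_nonneg _) (by positivity))
  have b4 : ‖expSecond Ψ Ψ₁ Ψ₂ f‖ ≤ ‖expSecond Ψ Ψ₁ Ψ₂‖ * ‖f‖ :=
    ContinuousLinearMap.le_opNorm _ _
  refine (norm_add_le _ _).trans ?_
  refine (add_le_add_left ((norm_sub_le _ _).trans
    (add_le_add_left (norm_sub_le _ _) _)) _).trans ?_
  linarith

end Conjugation

theorem conv_sum {ι : Type*} [AddCommGroup ι] {J : Type*} [Fintype J] (z : J → ℂ) {a : J → ι → ℂ}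
    (ha : ∀ j, Summable fun m => ‖a j m‖) :
    ∑ j, z j • conv (a j) = conv fun m => ∑ j, z j * a j m := by
  refine (HasSum.tsum_eq ?_).symm
  simpa [Finset.sum_smul, mul_smul] using
    hasSum_sum fun j (_ : j ∈ Finset.univ) => (hasSum_conv (ha j)).const_smul (z j)

/-! ### The symbol and localization in scaled frequency -/

variable {d : ℕ}

/-- The symbol `2π n_j + b_j + iρ e_j`. -/
def symb (b : Fin d → ℂ) (e : Fin d → ℝ) (ρ : ℝ) (j : Fin d) (n : Fin d → ℤ) : ℂ :=
  2 * (Real.pi : ℂ) * (n j : ℂ) + b j + Complex.I * (ρ : ℂ) * (e j : ℂ)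

theorem symb_sub (b : Fin d → ℂ) (e : Fin d → ℝ) (ρ : ℝ) (j : Fin d) (n m : Fin d → ℤ) :
    symb b e ρ j n = symb b e ρ j (n - m) + 2 * (Real.pi : ℂ) * (m j : ℂ) := by
  simp only [symb, Pi.sub_apply, Int.cast_sub]
  ring

/-- The frequency `2πn` in units of `ρ`. -/
def scaledFreq (ρ : ℝ) (n : Fin d → ℤ) : Fin d → ℝ := fun j => 2 * Real.pi * (n j : ℝ) / ρ

theorem norm_scaledFreq_sub_le {ρ : ℝ} (hρ : 0 < ρ) (n m : Fin d → ℤ) :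
    ‖scaledFreq ρ n - scaledFreq ρ (n - m)‖ ≤ 2 * Real.pi / ρ * ‖m‖ := by
  refine (pi_norm_le_iff_of_nonneg (by positivity)).2 fun j => ?_
  have : (scaledFreq ρ n - scaledFreq ρ (n - m)) j = 2 * Real.pi / ρ * (m j : ℝ) := by
    simp only [scaledFreq, Pi.sub_apply, Int.cast_sub]; ring
  rw [this, norm_mul, Real.norm_of_nonneg (by positivity)]
  refine mul_le_mul_of_nonneg_left ?_ (by positivity)
  have := norm_le_pi_norm m j
  rwa [Int.norm_eq_abs, ← Real.norm_eq_abs] at this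

/-- A Lipschitz cutoff equal to `1` on the ball of radius `τ / 2` and to `0` off that of radius
`τ`. -/
def bump (y : Fin d → ℝ) (τ : ℝ) (x : Fin d → ℝ) : ℝ := max 0 (min 1 (2 - 2 / τ * ‖x - y‖))

theorem bump_nonneg (y : Fin d → ℝ) (τ : ℝ) (x : Fin d → ℝ) : 0 ≤ bump y τ x := le_max_left _ _

theorem bump_le_one (y : Fin d → ℝ) (τ : ℝ) (x : Fin d → ℝ) : bump y τ x ≤ 1 :=
  max_le zero_le_one (min_le_left _ _)

theorem bump_eq_one {y : Fin d → ℝ} {τ : ℝ} (hτ : 0 < τ) {x : Fin d → ℝ} (h : ‖x - y‖ < τ / 2) :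
    bump y τ x = 1 := by
  have : 2 / τ * ‖x - y‖ ≤ 1 := by
    calc 2 / τ * ‖x - y‖ ≤ 2 / τ * (τ / 2) := by gcongr
      _ = 1 := by field_simp
  rw [bump, min_eq_left (by linarith), max_eq_right zero_le_one]

theorem bump_eq_zero {y : Fin d → ℝ} {τ : ℝ} (hτ : 0 < τ) {x : Fin d → ℝ} (h : τ ≤ ‖x - y‖) :
    bump y τ x = 0 := by
  have : 2 ≤ 2 / τ * ‖x - y‖ := by
    calc 2 = 2 / τ * τ := by field_simp
      _ ≤ 2 / τ * ‖x - y‖ := by gcongr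
  exact max_eq_left ((min_le_right _ _).trans (by linarith))

theorem abs_bump_sub_le {τ : ℝ} (hτ : 0 < τ) (y x x' : Fin d → ℝ) :
    |bump y τ x - bump y τ x'| ≤ 2 / τ * ‖x - x'‖ := by
  have h1 := abs_max_sub_max_le_abs (min 1 (2 - 2 / τ * ‖x - y‖)) (min 1 (2 - 2 / τ * ‖x' - y‖)) 0
  have h2 := abs_min_sub_min_le_max 1 (2 - 2 / τ * ‖x - y‖) 1 (2 - 2 / τ * ‖x' - y‖)
  rw [sub_self, abs_zero, max_eq_right (abs_nonneg _)] at h2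
  have h3 : |2 - 2 / τ * ‖x - y‖ - (2 - 2 / τ * ‖x' - y‖)| ≤ 2 / τ * ‖x - x'‖ := by
    have : 2 - 2 / τ * ‖x - y‖ - (2 - 2 / τ * ‖x' - y‖) = 2 / τ * (‖x' - y‖ - ‖x - y‖) := by ring
    rw [this, abs_mul, abs_of_pos (by positivity), norm_sub_rev x x']
    refine mul_le_mul_of_nonneg_left ((abs_norm_sub_norm_le _ _).trans (le_of_eq ?_))
      (by positivity)
    congr 1; abel
  unfold bump
  rw [max_comm 0, max_comm 0]
  exact h1.trans (h2.trans h3)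

/-- The part of `u` with scaled frequencies in `K` is bounded in terms of
`Pu = Σ ζ_j² u + 2 Σ X_j ζ_j u`, up to lower order terms, for large `ρ`. -/
def LocalBound (b : Fin d → ℂ) (e : Fin d → ℝ) (X : Fin d → Op (Fin d → ℤ))
    (K : Set (Fin d → ℝ)) : Prop :=
  ∃ C ρ₀ : ℝ, 0 ≤ C ∧ 1 ≤ ρ₀ ∧ ∀ ρ, ρ₀ ≤ ρ → ∀ (u : SeqL2 (Fin d → ℤ))
    (u₁ u₂ : Fin d → SeqL2 (Fin d → ℤ)), (∀ j n, u₁ j n = symb b e ρ j n * u n) →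
    (∀ j n, u₂ j n = symb b e ρ j n * u₁ j n) → ∀ v : SeqL2 (Fin d → ℤ),
    (∀ n, ‖v n‖ ≤ ‖u n‖) → (∀ n, scaledFreq ρ n ∉ K → v n = 0) →
    ρ * ‖v‖ ≤ C * (‖∑ j, u₂ j + (2 : ℂ) • ∑ j, X j (u₁ j)‖ + ‖u‖ + (∑ j, ‖u₁ j‖) / ρ)

namespace LocalBound

variable {b : Fin d → ℂ} {e : Fin d → ℝ} {X : Fin d → Op (Fin d → ℤ)} {K K' : Set (Fin d → ℝ)}

theorem empty : LocalBound b e X ∅ := by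
  refine ⟨0, 1, le_rfl, le_rfl, fun ρ _ u u₁ u₂ _ _ v _ hv => ?_⟩
  have : v = 0 := lp.ext (funext fun n => hv n (Set.notMem_empty _))
  simp [this]

theorem mono (hK : K ⊆ K') (h : LocalBound b e X K') : LocalBound b e X K := by
  obtain ⟨C, ρ₀, hC, hρ₀, H⟩ := h
  exact ⟨C, ρ₀, hC, hρ₀, fun ρ hρ u u₁ u₂ h₁ h₂ v hv hv' =>
    H ρ hρ u u₁ u₂ h₁ h₂ v hv fun n hn => hv' n fun hK' => hn (hK hK')⟩

/-- Because `v` is only required to be dominated by `u` entrywise, it can be split sharply along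
`K`; no smooth partition is needed. -/
theorem union (h : LocalBound b e X K) (h' : LocalBound b e X K') :
    LocalBound b e X (K ∪ K') := by
  classical
  obtain ⟨C, ρ₀, hC, hρ₀, H⟩ := h
  obtain ⟨C', ρ₀', hC', -, H'⟩ := h'
  refine ⟨C + C', max ρ₀ ρ₀', by positivity, hρ₀.trans (le_max_left _ _),
    fun ρ hρ u u₁ u₂ h₁ h₂ v hv hv' => ?_⟩
  obtain ⟨v₁, hv₁⟩ := exists_of_le (g := v) (C := 1)
    (φ := fun n => if scaledFreq ρ n ∈ K then v n else 0) (fun n => by split_ifs <;> simp)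
  obtain ⟨v₂, hv₂⟩ := exists_of_le (g := v) (C := 1)
    (φ := fun n => if scaledFreq ρ n ∈ K then 0 else v n) (fun n => by split_ifs <;> simp)
  have hρ1 : 0 ≤ ρ := zero_le_one.trans (hρ₀.trans ((le_max_left _ _).trans hρ))
  have e₁ := H ρ ((le_max_left _ _).trans hρ) u u₁ u₂ h₁ h₂ v₁
    (fun n => by rw [hv₁]; split_ifs <;> simp [hv n]) (fun n hn => by rw [hv₁, if_neg hn])
  have e₂ := H' ρ ((le_max_right _ _).trans hρ) u u₁ u₂ h₁ h₂ v₂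
    (fun n => by rw [hv₂]; split_ifs <;> simp [hv n]) (fun n hn => by
      rw [hv₂]
      split_ifs with hK
      · rfl
      · exact hv' n (by simp [hK, hn]))
  have e₃ : ‖v‖ ≤ ‖v₁‖ + ‖v₂‖ := norm_le_add fun n => by
    rw [hv₁, hv₂]; split_ifs <;> simp
  calc ρ * ‖v‖ ≤ ρ * (‖v₁‖ + ‖v₂‖) := by gcongr
    _ ≤ _ := by linarith

theorem of_isCompact (hK : IsCompact K) (h : ∀ y ∈ K, ∃ t ∈ nhds y, LocalBound b e X t) :
    LocalBound b e X K :=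
  hK.induction_on empty (fun _ _ => mono) (fun _ _ => union) fun y hy => by
    obtain ⟨t, ht, H⟩ := h y hy
    exact ⟨t, mem_nhdsWithin_of_mem_nhds ht, H⟩

end LocalBound

/-- The cutoff commutes with the symbols, so only its commutators with the convolutions appear. They
are `O(1/ρ)`, since a step `m` moves the scaled frequency by at most `2π‖m‖/ρ`. -/
theorem norm_square_cutoff_le {a : Fin d → (Fin d → ℤ) → ℂ}
    (ha : ∀ j, Summable fun m => ‖a j m‖) (ha' : ∀ j, Summable fun m => ‖a j m‖ * ‖m‖)
    {y : Fin d → ℝ} {τ ρ : ℝ} (hτ : 0 < τ) (hρ : 0 < ρ)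
    {u₁ u₂ f₁ f₂ : Fin d → SeqL2 (Fin d → ℤ)}
    (hf₁ : ∀ j n, f₁ j n = (bump y τ (scaledFreq ρ n) : ℂ) * u₁ j n)
    (hf₂ : ∀ j n, f₂ j n = (bump y τ (scaledFreq ρ n) : ℂ) * u₂ j n) :
    ‖∑ j, f₂ j + (2 : ℂ) • ∑ j, conv (a j) (f₁ j)‖ ≤
      ‖∑ j, u₂ j + (2 : ℂ) • ∑ j, conv (a j) (u₁ j)‖ +
        2 * (4 * Real.pi / τ * ∑ j, ∑' m, ‖a j m‖ * ‖m‖) * ((∑ j, ‖u₁ j‖) / ρ) := by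
  have hc : ∀ n, ‖(bump y τ (scaledFreq ρ n) : ℂ)‖ ≤ 1 := fun n => by
    rw [Complex.norm_real, Real.norm_of_nonneg (bump_nonneg _ _ _)]
    exact bump_le_one _ _ _
  set D := diag (fun n => (bump y τ (scaledFreq ρ n) : ℂ)) 1 hc with hD
  have hDf₁ : ∀ j, f₁ j = D (u₁ j) := fun j => lp.ext (funext fun n => by rw [hf₁, hD, diag_apply])
  have hDf₂ : ∀ j, f₂ j = D (u₂ j) := fun j => lp.ext (funext fun n => by rw [hf₂, hD, diag_apply])
  have hL : ∀ n m : Fin d → ℤ, ‖(bump y τ (scaledFreq ρ n) : ℂ) -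
      (bump y τ (scaledFreq ρ (n - m)) : ℂ)‖ ≤ 4 * Real.pi / τ / ρ * ‖m‖ := fun n m => by
    rw [← Complex.ofReal_sub, Complex.norm_real, Real.norm_eq_abs]
    refine (abs_bump_sub_le hτ _ _ _).trans ?_
    calc _ ≤ 2 / τ * (2 * Real.pi / ρ * ‖m‖) :=
        mul_le_mul_of_nonneg_left (norm_scaledFreq_sub_le hρ n m) (by positivity)
      _ = _ := by ring
  have hcomm : ∀ j, ‖D * conv (a j) - conv (a j) * D‖ ≤
      4 * Real.pi / τ / ρ * ∑' m, ‖a j m‖ * ‖m‖ := fun j => by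
    have e1 : ∀ m : Fin d → ℤ, ‖a j m‖ * (4 * Real.pi / τ / ρ * ‖m‖) =
      4 * Real.pi / τ / ρ * (‖a j m‖ * ‖m‖) := fun m => by ring
    have := norm_commutator_diag_conv_le hc hL (ha j) (by
      simp only [e1]; exact (ha' j).mul_left _)
    simpa only [e1, tsum_mul_left] using this
  have hk : ∑ j, f₂ j + (2 : ℂ) • ∑ j, conv (a j) (f₁ j) =
      D (∑ j, u₂ j + (2 : ℂ) • ∑ j, conv (a j) (u₁ j)) -
        (2 : ℂ) • ∑ j, (D * conv (a j) - conv (a j) * D) (u₁ j) := by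
    simp only [hDf₁, hDf₂, map_add, map_smul, map_sum, _root_.sub_apply, mul_apply_eq_comp,
      Finset.sum_sub_distrib, smul_sub]
    abel
  rw [hk]
  refine (norm_sub_le _ _).trans (add_le_add ?_ ?_)
  · refine (ContinuousLinearMap.le_opNorm _ _).trans ?_
    exact mul_le_of_le_one_left (norm_nonneg _) (norm_diag_le _ _ _)
  · rw [norm_smul, Complex.norm_ofNat, mul_assoc]
    refine mul_le_mul_of_nonneg_left ?_ (by norm_num)
    calc ‖∑ j, (D * conv (a j) - conv (a j) * D) (u₁ j)‖
        ≤ ∑ j, (4 * Real.pi / τ / ρ * ∑ i, ∑' m, ‖a i m‖ * ‖m‖) * ‖u₁ j‖ := by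
          refine norm_sum_le_of_le _ fun j _ => (ContinuousLinearMap.le_opNorm _ _).trans ?_
          refine mul_le_mul_of_nonneg_right ((hcomm j).trans ?_) (norm_nonneg _)
          refine mul_le_mul_of_nonneg_left ?_ (by positivity)
          exact Finset.single_le_sum (f := fun i => ∑' m, ‖a i m‖ * ‖m‖)
            (fun i _ => tsum_nonneg fun m => by positivity) (Finset.mem_univ j)
      _ = _ := by rw [← Finset.mul_sum]; ring

/-- The operator `G = exp Ψ` and the constants depend on `y` and `F` but not on `ρ`. The error `(2
K₁ t + K₂) ‖f‖` is thus harmless once `t` is a small multiple of `ρ` and `ρ` is large. -/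
theorem exists_conjugation {b : Fin d → ℂ} {e : Fin d → ℝ} {a : Fin d → (Fin d → ℤ) → ℂ}
    (ha : ∀ j, Summable fun m => ‖a j m‖)
    {c ρ₁ : ℝ} (hc : 0 < c)
    (hlow : ∀ ρ, ρ₁ ≤ ρ → ∀ n, c * ρ ≤ ‖∑ j, symb b e ρ j n ^ 2‖)
    (F : Finset (Fin d → ℤ)) (hF : ∀ m ∈ F, ∑ j, e j * (m j : ℝ) ≠ 0) (y : Fin d → ℝ)
    (hres : 2 * ∑ j, ‖(y j : ℂ) + Complex.I * (e j : ℂ)‖ *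
      ∑' m, (if m ∈ F then 0 else ‖a j m‖) ≤ c / 4) :
    ∃ (G : Op (Fin d → ℤ)) (M K₁ K₂ : ℝ), 0 ≤ M ∧ 0 ≤ K₁ ∧ 0 ≤ K₂ ∧ (∀ f, ‖f‖ ≤ M * ‖G f‖) ∧
      ∀ ρ t : ℝ, ρ₁ ≤ ρ → 0 ≤ ρ → 0 ≤ t → ∀ (f : SeqL2 (Fin d → ℤ))
        (f₁ f₂ : Fin d → SeqL2 (Fin d → ℤ)), (∀ j n, f₁ j n = symb b e ρ j n * f n) →
        (∀ j n, f₂ j n = symb b e ρ j n * f₁ j n) →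
        (∀ j n, ‖(symb b e ρ j n - ρ * ((y j : ℂ) + Complex.I * (e j : ℂ))) * f n‖ ≤ t * ‖f n‖) →
        3 / 4 * c * (ρ * ‖G f‖) ≤ ‖G‖ * ‖∑ j, f₂ j + (2 : ℂ) • ∑ j, conv (a j) (f₁ j)‖ +
          (2 * K₁ * t + K₂) * ‖f‖ := by
  classical
  set z : Fin d → ℂ := fun j => (y j : ℂ) + Complex.I * (e j : ℂ) with hz
  -- The imaginary part of `z·m` is `e·m`.
  have hzm : ∀ m ∈ F, ∑ j, z j * (m j : ℂ) ≠ 0 := fun m hm h => hF m hm (by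
    have := congrArg Complex.im h
    simpa [hz] using this)
  -- Solves `Σ z_j · 2πm_j ψ(m) = Σ z_j a_j(m)` on `F`. Having finite support, `ψ` gives bounded
  -- operators together with all its commutators.
  set ψ : (Fin d → ℤ) → ℂ := fun m =>
    if m ∈ F then (∑ j, z j * a j m) / (2 * Real.pi * ∑ j, z j * (m j : ℂ)) else 0 with hψ
  have hfin : ∀ g : (Fin d → ℤ) → ℂ, (∀ m, m ∉ F → g m = 0) → Summable fun m => ‖g m‖ :=
    fun g hg => summable_of_ne_finset_zero (s := F) fun m hm => by rw [hg m hm, norm_zero]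
  have hψ0 : ∀ m, m ∉ F → ψ m = 0 := fun m hm => if_neg hm
  have s0 := hfin ψ hψ0
  have s1 : ∀ j, Summable fun m : Fin d → ℤ => ‖2 * (Real.pi : ℂ) * (m j : ℂ) * ψ m‖ := fun j =>
    hfin _ fun m hm => by rw [hψ0 m hm, mul_zero]
  have s2 : ∀ j, Summable fun m : Fin d → ℤ =>
      ‖2 * (Real.pi : ℂ) * (m j : ℂ) * (2 * (Real.pi : ℂ) * (m j : ℂ) * ψ m)‖ := fun j =>
    hfin _ fun m hm => by rw [hψ0 m hm, mul_zero, mul_zero]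
  set Ψ : Op (Fin d → ℤ) := conv ψ with hΨ
  set Ψ₁ : Fin d → Op (Fin d → ℤ) := fun j => conv fun m => 2 * (Real.pi : ℂ) * (m j : ℂ) * ψ m
    with hΨ₁
  set Ψ₂ : Fin d → Op (Fin d → ℤ) := fun j =>
    conv fun m => 2 * (Real.pi : ℂ) * (m j : ℂ) * (2 * (Real.pi : ℂ) * (m j : ℂ) * ψ m) with hΨ₂
  set aF : Fin d → (Fin d → ℤ) → ℂ := fun j m => if m ∈ F then a j m else 0 with haF
  set aR : Fin d → (Fin d → ℤ) → ℂ := fun j m => if m ∈ F then 0 else a j m with haR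
  have sF : ∀ j, Summable fun m => ‖aF j m‖ := fun j => hfin _ fun m hm => if_neg hm
  have sR : ∀ j, Summable fun m => ‖aR j m‖ := fun j =>
    (ha j).of_nonneg_of_le (fun _ => norm_nonneg _) fun m => by
      simp only [haR]; split_ifs <;> simp
  have hX : ∀ j, conv (a j) = conv (aF j) + conv (aR j) := fun j => by
    rw [← conv_add (sF j) (sR j)]
    congr 1; ext m
    simp only [haF, haR]; split_ifs <;> simp
  have hzz : ∑ j, z j • conv (aF j) = ∑ j, z j • Ψ₁ j := by
    rw [conv_sum z sF, hΨ₁, conv_sum z s1]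
    congr 1; ext m
    by_cases hm : m ∈ F
    · have hp : (2 : ℂ) * Real.pi ≠ 0 := by simp [Real.pi_ne_zero]
      have h1 : ∑ j, z j * (2 * (Real.pi : ℂ) * (m j : ℂ) * ψ m) =
          ψ m * (2 * Real.pi * ∑ j, z j * (m j : ℂ)) := by
        rw [Finset.mul_sum, Finset.mul_sum]
        exact Finset.sum_congr rfl fun j _ => by ring
      rw [h1]
      simp only [hψ, haF, if_pos hm]
      rw [div_mul_cancel₀ _ (mul_ne_zero hp (hzm m hm))]
    · simp [haF, hψ0 m hm, hm]
  have hXR : 2 * ∑ j, ‖z j‖ * ‖conv (aR j)‖ ≤ c / 4 := by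
    refine le_trans ?_ hres
    gcongr with j
    refine (norm_conv_le (sR j)).trans (le_of_eq (tsum_congr fun m => ?_))
    simp only [haR]; split_ifs <;> simp
  refine ⟨NormedSpace.exp Ψ, ‖NormedSpace.exp (-Ψ)‖,
    ∑ j, ‖conv (a j) - Ψ₁ j‖ * ‖NormedSpace.exp Ψ‖, ‖expSecond Ψ Ψ₁ Ψ₂‖, norm_nonneg _,
    Finset.sum_nonneg fun j _ => mul_nonneg (norm_nonneg _) (norm_nonneg _), norm_nonneg _,
    norm_le_norm_exp_neg_mul Ψ, fun ρ t hρ₁ hρ₀ ht f f₁ f₂ hf₁ hf₂ hr => ?_⟩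
  have main := conjugated_lower_bound (ζ := symb b e ρ) (Ψ := Ψ) (Ψ₁ := Ψ₁) (Ψ₂ := Ψ₂)
    (X := fun j => conv (a j)) (XF := fun j => conv (aF j)) (XR := fun j => conv (aR j))
    (fun j => hasCommutator_conv (symb_sub b e ρ j) s0 (s1 j))
    (fun j => hasCommutator_conv (symb_sub b e ρ j) (s1 j) (s2 j))
    (fun j => conv_commute_conv _ _) (fun j => conv_commute_conv _ _) hX hzz hρ₀ hc.le
    ht (hlow ρ hρ₁) hf₁ hf₂ hr
  have t1 := mul_le_mul_of_nonneg_right hXR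
    (mul_nonneg hρ₀ (norm_nonneg (NormedSpace.exp Ψ f)))
  linarith

/-- Of the coefficient `3c/4`, one quarter of `c` pays for the size `τ` of the neighbourhood and
another for the terms beaten by large `ρ`; the last quarter remains. -/
theorem local_bound_arith {c M K₁ K₂ B L τ ρ g h P Q U S F V : ℝ} (hc : 0 < c) (hM : 0 ≤ M)
    (hK₁ : 0 ≤ K₁) (hK₂ : 0 ≤ K₂) (hB : 0 ≤ B) (hL : 0 ≤ L) (hτ : 0 ≤ τ) (hρ : 0 < ρ)
    (hg : 0 ≤ g) (hh : 0 ≤ h) (hQ : 0 ≤ Q) (hU : 0 ≤ U) (hS : 0 ≤ S)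
    (hτ' : 2 * K₁ * τ * M ≤ c / 4) (hρ' : (2 * K₁ * B + K₂) * M ≤ c / 4 * ρ)
    (main : 3 / 4 * c * (ρ * h) ≤ g * P + (2 * K₁ * (τ * ρ + B) + K₂) * F) (hF : F ≤ M * h)
    (hV : V ≤ F) (hP : P ≤ Q + 2 * L * S) :
    ρ * V ≤ 4 * M / c * g * (1 + 2 * L) * (Q + U + S) := by
  have t2 : (2 * K₁ * (τ * ρ + B) + K₂) * F ≤ c / 2 * (ρ * h) := by
    calc (2 * K₁ * (τ * ρ + B) + K₂) * F ≤ (2 * K₁ * (τ * ρ + B) + K₂) * (M * h) := by gcongr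
      _ = (2 * K₁ * τ * M) * (ρ * h) + ((2 * K₁ * B + K₂) * M) * h := by ring
      _ ≤ (c / 4) * (ρ * h) + (c / 4 * ρ) * h := by gcongr
      _ = c / 2 * (ρ * h) := by ring
  have t4 : ρ * h ≤ 4 / c * (g * P) := by
    rw [div_mul_eq_mul_div, le_div_iff₀ hc]; linarith
  have t5 : Q + 2 * L * S ≤ (1 + 2 * L) * (Q + U + S) := by
    nlinarith [mul_nonneg hL hQ, mul_nonneg hL hU]
  calc ρ * V ≤ ρ * (M * h) := by gcongr; exact hV.trans hF
    _ = M * (ρ * h) := by ring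
    _ ≤ M * (4 / c * (g * (Q + 2 * L * S))) := by
        refine mul_le_mul_of_nonneg_left (t4.trans ?_) hM
        gcongr
    _ = 4 * M / c * g * (Q + 2 * L * S) := by ring
    _ ≤ 4 * M / c * g * ((1 + 2 * L) * (Q + U + S)) := by gcongr
    _ = _ := by ring

theorem exists_nhds_localBound {b : Fin d → ℂ} {e : Fin d → ℝ} {a : Fin d → (Fin d → ℤ) → ℂ}
    (ha : ∀ j, Summable fun m => ‖a j m‖) (ha' : ∀ j, Summable fun m => ‖a j m‖ * ‖m‖)
    {c ρ₁ : ℝ} (hc : 0 < c)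
    (hlow : ∀ ρ, ρ₁ ≤ ρ → ∀ n, c * ρ ≤ ‖∑ j, symb b e ρ j n ^ 2‖)
    (F : Finset (Fin d → ℤ)) (hF : ∀ m ∈ F, ∑ j, e j * (m j : ℝ) ≠ 0) (y : Fin d → ℝ)
    (hres : 2 * ∑ j, ‖(y j : ℂ) + Complex.I * (e j : ℂ)‖ *
      ∑' m, (if m ∈ F then 0 else ‖a j m‖) ≤ c / 4) :
    ∃ t ∈ nhds y, LocalBound b e (fun j => conv (a j)) t := by
  obtain ⟨G, M, K₁, K₂, hM0, hK₁0, hK₂0, hfh, main⟩ :=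
    exists_conjugation ha hc hlow F hF y hres
  set B := ∑ j, ‖b j‖ with hB
  have hB0 : 0 ≤ B := by positivity
  -- The radius only has to give `2 K₁ τ M ≤ c / 4`; the `+ 1` avoids division by zero.
  set τ := c / (8 * (K₁ * M + 1)) with hτdef
  have hτ : 0 < τ := by positivity
  have hτ' : 2 * K₁ * τ * M ≤ c / 4 := by
    have : τ * (8 * (K₁ * M + 1)) = c := div_mul_cancel₀ _ (by positivity)
    nlinarith
  set L := 4 * Real.pi / τ * ∑ j, ∑' m, ‖a j m‖ * ‖m‖ with hL
  have hL0 : 0 ≤ L := mul_nonneg (by positivity)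
    (Finset.sum_nonneg fun j _ => tsum_nonneg fun m => by positivity)
  refine ⟨Metric.ball y (τ / 2), Metric.ball_mem_nhds _ (by positivity),
    4 * M / c * ‖G‖ * (1 + 2 * L), max (max 1 ρ₁) (4 * ((2 * K₁ * B + K₂) * M) / c),
    by positivity, (le_max_left _ _).trans (le_max_left _ _),
    fun ρ hρ u u₁ u₂ h₁ h₂ v hv hv' => ?_⟩
  have hρ1 : 1 ≤ ρ := ((le_max_left _ _).trans (le_max_left _ _)).trans hρ
  have hρ0 : 0 < ρ := by linarith
  have hρ2 : ρ₁ ≤ ρ := ((le_max_right _ _).trans (le_max_left _ _)).trans hρ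
  have hρ3 : (2 * K₁ * B + K₂) * M ≤ c / 4 * ρ := by
    have := (le_max_right _ _).trans hρ
    rw [div_le_iff₀ hc] at this
    linarith
  have hex : ∀ g : SeqL2 (Fin d → ℤ), ∃ f : SeqL2 (Fin d → ℤ),
      ∀ n, f n = (bump y τ (scaledFreq ρ n) : ℂ) * g n := fun g =>
    exists_of_le (g := g) (C := 1) fun n => by
      rw [norm_mul, Complex.norm_real, Real.norm_of_nonneg (bump_nonneg _ _ _)]
      exact mul_le_mul_of_nonneg_right (bump_le_one _ _ _) (norm_nonneg _)
  obtain ⟨f, hf⟩ := hex u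
  choose f₁ hf₁ using fun j => hex (u₁ j)
  choose f₂ hf₂ using fun j => hex (u₂ j)
  have hf₁' : ∀ j n, f₁ j n = symb b e ρ j n * f n := fun j n => by rw [hf₁, hf, h₁]; ring
  have hf₂' : ∀ j n, f₂ j n = symb b e ρ j n * f₁ j n := fun j n => by rw [hf₂, hf₁, h₂]; ring
  have hr : ∀ j n, ‖(symb b e ρ j n - ρ * ((y j : ℂ) + Complex.I * (e j : ℂ))) * f n‖ ≤
      (τ * ρ + B) * ‖f n‖ := fun j n => by
    rw [norm_mul]
    by_cases hs : τ ≤ ‖scaledFreq ρ n - y‖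
    · rw [hf, bump_eq_zero hτ hs]; simp
    · refine mul_le_mul_of_nonneg_right ?_ (norm_nonneg _)
      have e1 : symb b e ρ j n - ρ * ((y j : ℂ) + Complex.I * (e j : ℂ)) = ((ρ * (scaledFreq ρ n - y) j : ℝ) : ℂ) + b j := by
        simp only [symb, scaledFreq, Pi.sub_apply]
        have hρC : (ρ : ℂ) ≠ 0 := by exact_mod_cast hρ0.ne'
        push_cast
        field_simp
        ring
      rw [e1]
      refine (norm_add_le _ _).trans (add_le_add ?_ ?_)
      · rw [Complex.norm_real, norm_mul, Real.norm_of_nonneg hρ0.le, mul_comm]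
        exact mul_le_mul_of_nonneg_right ((norm_le_pi_norm _ j).trans (not_le.1 hs).le) hρ0.le
      · exact Finset.single_le_sum (f := fun j => ‖b j‖) (fun i _ => norm_nonneg _)
          (Finset.mem_univ j)
  have main := main ρ (τ * ρ + B) hρ2 hρ0.le (by positivity) f f₁ f₂ hf₁' hf₂' hr
  have hcut := norm_square_cutoff_le ha ha' hτ hρ0 hf₁ hf₂
  rw [← hL] at hcut
  have hvf : ‖v‖ ≤ ‖f‖ := by
    refine lp.norm_mono (by simp) fun n => ?_
    by_cases hn : scaledFreq ρ n ∈ Metric.ball y (τ / 2)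
    · rw [hf, bump_eq_one hτ (by simpa [dist_eq_norm] using hn)]
      simpa using hv n
    · rw [hv' n hn]; simp
  exact local_bound_arith hc hM0 hK₁0 hK₂0 hB0 hL0 hτ.le hρ0 (norm_nonneg _) (norm_nonneg _)
    (norm_nonneg _) (norm_nonneg _) (by positivity) hτ' hρ3 main (hfh f) hvf hcut

/-! ### From local bounds to the global estimate -/

variable {d : ℕ} {b : Fin d → ℂ} {e : Fin d → ℝ}

theorem sum_square_apply {ρ : ℝ} {u : SeqL2 (Fin d → ℤ)} {u₁ u₂ : Fin d → SeqL2 (Fin d → ℤ)}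
    (h₁ : ∀ j n, u₁ j n = symb b e ρ j n * u n) (h₂ : ∀ j n, u₂ j n = symb b e ρ j n * u₁ j n)
    (n : Fin d → ℤ) : (∑ j, u₂ j) n = (∑ j, symb b e ρ j n ^ 2) * u n := by
  rw [lp.coeFn_sum, Finset.sum_apply, Finset.sum_mul]
  exact Finset.sum_congr rfl fun j _ => by rw [h₂, h₁]; ring

theorem norm_sum_square_le {ι : Type*} {J : Type*} [Fintype J] (X : J → Op ι)
    (u₁ u₂ : J → SeqL2 ι) :
    ‖∑ j, u₂ j‖ ≤ ‖∑ j, u₂ j + (2 : ℂ) • ∑ j, X j (u₁ j)‖ +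
      2 * (∑ j, ‖X j‖) * ∑ j, ‖u₁ j‖ := by
  have h1 : ∑ j, u₂ j = (∑ j, u₂ j + (2 : ℂ) • ∑ j, X j (u₁ j)) - (2 : ℂ) • ∑ j, X j (u₁ j) := by
    abel
  conv_lhs => rw [h1]
  refine (norm_sub_le _ _).trans (add_le_add le_rfl ?_)
  rw [norm_smul, Complex.norm_ofNat, mul_assoc]
  refine mul_le_mul_of_nonneg_left ?_ (by norm_num)
  rw [Finset.mul_sum]
  refine norm_sum_le_of_le _ fun j _ => (ContinuousLinearMap.le_opNorm _ _).trans ?_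
  exact mul_le_mul_of_nonneg_right (Finset.single_le_sum (f := fun i => ‖X i‖)
    (fun i _ => norm_nonneg _) (Finset.mem_univ j)) (norm_nonneg _)

theorem elliptic_arith {ρ A Q T S U V : ℝ} (hρ : 0 < ρ) (hA : 0 ≤ A) (hρ1 : 1 ≤ ρ) (hQ : 0 ≤ Q)
    (hU : 0 ≤ U) (hS : 0 ≤ S) (h3 : ρ ^ 2 * V ≤ T) (h4 : T ≤ Q + 2 * A * S) :
    ρ * V ≤ (1 + 2 * A) * (Q + U + S / ρ) := by
  obtain ⟨S, rfl⟩ : ∃ S', S = ρ * S' := ⟨S / ρ, by field_simp⟩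
  rw [mul_div_cancel_left₀ _ hρ.ne']
  have hS' : 0 ≤ S := nonneg_of_mul_nonneg_right hS hρ
  have h5 : ρ * (ρ * V) ≤ ρ * (Q + 2 * A * S) := by nlinarith
  have h6 := le_of_mul_le_mul_left h5 hρ
  nlinarith [mul_nonneg hA hQ, mul_nonneg hA hU]

theorem localBound_compl_closedBall (X : Fin d → Op (Fin d → ℤ)) {R ρ₁ : ℝ}
    (hfar : ∀ ρ, ρ₁ ≤ ρ → ∀ n, R < ‖scaledFreq ρ n‖ → ρ ^ 2 ≤ ‖∑ j, symb b e ρ j n ^ 2‖) :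
    LocalBound b e X (Metric.closedBall 0 R)ᶜ := by
  refine ⟨1 + 2 * ∑ j, ‖X j‖, max 1 ρ₁, by positivity, le_max_left _ _,
    fun ρ hρ u u₁ u₂ h₁ h₂ v hv hv' => ?_⟩
  have hρ1 : 1 ≤ ρ := (le_max_left _ _).trans hρ
  have hρ0 : 0 < ρ := by linarith
  have h3 : ρ ^ 2 * ‖v‖ ≤ ‖∑ j, u₂ j‖ := by
    have := norm_le_mul (f := ((ρ ^ 2 : ℝ) : ℂ) • v) (g := ∑ j, u₂ j) zero_le_one fun n => by
      rw [norm_ofReal_smul_apply, abs_of_nonneg (by positivity), one_mul,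
        sum_square_apply h₁ h₂ n, norm_mul]
      by_cases hn : scaledFreq ρ n ∈ (Metric.closedBall 0 R)ᶜ
      · exact mul_le_mul (hfar ρ ((le_max_right _ _).trans hρ) n (by simpa using hn)) (hv n)
          (norm_nonneg _) (norm_nonneg _)
      · rw [hv' n hn, norm_zero, mul_zero]; positivity
    rwa [norm_ofReal_smul, one_mul, abs_of_nonneg (by positivity)] at this
  have h4 := norm_sum_square_le X u₁ u₂
  exact elliptic_arith hρ0 (Finset.sum_nonneg fun j _ => norm_nonneg _) hρ1 (norm_nonneg _)
    (norm_nonneg _) (Finset.sum_nonneg fun j _ => norm_nonneg _) h3 h4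

/-- One has `|ζ_i|² = Re ζ_i² + 2 (Im ζ_i)²` with `Im ζ_i = O(ρ)`, so `|ζ_j|²` is controlled by `|Σ
ζ_i²| + O(ρ²)`; then `ρ|ζ_j| ≤ (ρ² + |ζ_j|²)/2`. -/
theorem norm_symb_mul_le {ρ : ℝ} (hρ : 1 ≤ ρ) (j : Fin d) (n : Fin d → ℤ) :
    ρ * ‖symb b e ρ j n‖ ≤ ‖∑ i, symb b e ρ i n ^ 2‖ +
      (1 + 2 * ∑ i, (‖b i‖ + |e i|) ^ 2) * ρ ^ 2 := by
  set ζ := fun i => symb b e ρ i n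
  have h1 : ∀ i, ‖ζ i‖ ^ 2 ≤ (ζ i ^ 2).re + 2 * ((‖b i‖ + |e i|) ^ 2 * ρ ^ 2) := fun i => by
    have h2 : |(ζ i).im| ≤ (‖b i‖ + |e i|) * ρ := by
      have : (ζ i).im = (b i).im + ρ * e i := by simp [ζ, symb]
      rw [this]
      refine (abs_add_le _ _).trans ?_
      rw [abs_mul, abs_of_nonneg (zero_le_one.trans hρ)]
      nlinarith [Complex.abs_im_le_norm (b i), norm_nonneg (b i)]
    have h3 : (ζ i).im ^ 2 ≤ (‖b i‖ + |e i|) ^ 2 * ρ ^ 2 := by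
      rw [← mul_pow, ← sq_abs]
      exact pow_le_pow_left₀ (abs_nonneg _) h2 2
    rw [← Complex.normSq_eq_norm_sq, Complex.normSq_apply, pow_two (ζ i), Complex.mul_re]
    nlinarith
  have h4 : ‖ζ j‖ ^ 2 ≤ ‖∑ i, ζ i ^ 2‖ + 2 * (∑ i, (‖b i‖ + |e i|) ^ 2) * ρ ^ 2 := by
    calc ‖ζ j‖ ^ 2 ≤ ∑ i, ‖ζ i‖ ^ 2 := Finset.single_le_sum (f := fun i => ‖ζ i‖ ^ 2)
          (fun i _ => by positivity) (Finset.mem_univ j)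
      _ ≤ ∑ i, ((ζ i ^ 2).re + 2 * ((‖b i‖ + |e i|) ^ 2 * ρ ^ 2)) :=
          Finset.sum_le_sum fun i _ => h1 i
      _ = (∑ i, ζ i ^ 2).re + 2 * (∑ i, (‖b i‖ + |e i|) ^ 2) * ρ ^ 2 := by
          rw [Finset.sum_add_distrib, ← Finset.mul_sum, ← Finset.sum_mul, Complex.re_sum, mul_assoc]
      _ ≤ _ := by gcongr; exact Complex.re_le_norm _
  change ρ * ‖ζ j‖ ≤ ‖∑ i, ζ i ^ 2‖ + _
  nlinarith [sq_nonneg (ρ - ‖ζ j‖), norm_nonneg (∑ i, ζ i ^ 2),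
    mul_nonneg (Finset.sum_nonneg fun i (_ : i ∈ Finset.univ) => sq_nonneg (‖b i‖ + |e i|))
      (sq_nonneg ρ), sq_nonneg ρ, sq_nonneg ‖ζ j‖]

/-- By `h2`, `S` is at most a constant times `W + ρU`, so the error `S / ρ` in `h1` is of the same
order as `U` and is absorbed by `ρU` for large `ρ`. -/
theorem absorb_arith {C D E A β Q U S W ρ : ℝ} (hC : 0 ≤ C) (hD : 0 ≤ D) (hE : 0 ≤ E)
    (hβ : 0 ≤ β) (hU : 0 ≤ U) (hS : 0 ≤ S)
    (hQW : Q ≤ W + β * U) (h1 : ρ * U ≤ C * (Q + U + S / ρ))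
    (h2 : ρ * S ≤ E * (Q + A * S) + D * ρ ^ 2 * U) (hρ1 : 1 ≤ ρ) (hρE : 2 * (E * A) ≤ ρ)
    (hρC : 2 * (C * (β + 1 + 2 * E * β + 2 * D)) ≤ ρ) (hW : 0 ≤ W) :
    ρ * U + S ≤ (2 * E + (2 * E * β + 2 * D + 1) * (2 * (C * (1 + 2 * E)))) * W := by
  have hρ0 : 0 < ρ := by linarith
  obtain ⟨T, rfl⟩ : ∃ T, S = ρ * T := ⟨S / ρ, by field_simp⟩
  rw [mul_div_cancel_left₀ _ hρ0.ne'] at h1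
  have hT : 0 ≤ T := nonneg_of_mul_nonneg_right hS hρ0
  have h3 : ρ * (ρ * T) ≤ 2 * E * Q + 2 * D * ρ ^ 2 * U := by nlinarith [mul_nonneg hρ0.le hT]
  have hEQ : E * Q ≤ E * (W + β * U) := mul_le_mul_of_nonneg_left hQW hE
  have hEW : 0 ≤ E * W := mul_nonneg hE hW
  have hEβ : 0 ≤ E * β := mul_nonneg hE hβ
  have h4 : ρ * (ρ * T) ≤ ρ * (2 * E * W + 2 * E * β * U + 2 * D * ρ * U) := by
    nlinarith [mul_nonneg hEβ hU]
  have h5 := le_of_mul_le_mul_left h4 hρ0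
  have h6 : ρ * T ≤ ρ * (2 * E * W + 2 * E * β * U + 2 * D * U) := by
    nlinarith [mul_nonneg hEβ hU]
  have h7 := le_of_mul_le_mul_left h6 hρ0
  have h8 : ρ * U ≤ C * ((1 + 2 * E) * W + (β + 1 + 2 * E * β + 2 * D) * U) :=
    h1.trans (mul_le_mul_of_nonneg_left (by linarith) hC)
  have h9 : ρ * U ≤ 2 * (C * (1 + 2 * E)) * W := by
    nlinarith [mul_le_mul_of_nonneg_right hρC hU]
  have h10 : 2 * E * β * U ≤ 2 * E * β * (ρ * U) := by
    nlinarith [mul_nonneg hEβ hU]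
  have h11 := mul_le_mul_of_nonneg_left h9 (by positivity : 0 ≤ 2 * E * β + 2 * D + 1)
  nlinarith

/-- The a priori estimate for `Σ ζ_j² + 2 Σ X_j ζ_j + B`, where `X_j` is convolution with `a_j`. -/
theorem exists_estimate {a : Fin d → (Fin d → ℤ) → ℂ}
    (ha : ∀ j, Summable fun m => ‖a j m‖) (ha' : ∀ j, Summable fun m => ‖a j m‖ * ‖m‖)
    {c ρ₁ R : ℝ} (hc : 0 < c)
    (hlow : ∀ ρ, ρ₁ ≤ ρ → ∀ n, c * ρ ≤ ‖∑ j, symb b e ρ j n ^ 2‖)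
    (hfar : ∀ ρ, ρ₁ ≤ ρ → ∀ n, R < ‖scaledFreq ρ n‖ → ρ ^ 2 ≤ ‖∑ j, symb b e ρ j n ^ 2‖)
    (F : Finset (Fin d → ℤ)) (hF : ∀ m ∈ F, ∑ j, e j * (m j : ℝ) ≠ 0)
    (hres : ∀ y : Fin d → ℝ, ‖y‖ ≤ R → 2 * ∑ j, ‖(y j : ℂ) + Complex.I * (e j : ℂ)‖ *
      ∑' m, (if m ∈ F then 0 else ‖a j m‖) ≤ c / 4) (B : Op (Fin d → ℤ)) :
    ∃ C ρ₀ : ℝ, 0 < C ∧ ∀ ρ, ρ₀ ≤ ρ → ∀ (u : SeqL2 (Fin d → ℤ))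
      (u₁ u₂ : Fin d → SeqL2 (Fin d → ℤ)), (∀ j n, u₁ j n = symb b e ρ j n * u n) →
      (∀ j n, u₂ j n = symb b e ρ j n * u₁ j n) →
      ρ * ‖u‖ + ∑ j, ‖u₁ j‖ ≤ C * ‖∑ j, u₂ j + (2 : ℂ) • ∑ j, conv (a j) (u₁ j) + B u‖ := by
  have hball : LocalBound b e (fun j => conv (a j)) (Metric.closedBall 0 R) :=
    LocalBound.of_isCompact (isCompact_closedBall 0 R) fun y hy =>
      exists_nhds_localBound ha ha' hc hlow F hF y (hres y (by simpa using hy))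
  have huniv := hball.union (localBound_compl_closedBall (fun j => conv (a j)) hfar)
  rw [Set.union_compl_self] at huniv
  obtain ⟨C, ρ₀, hC, hρ₀, H⟩ := huniv
  obtain ⟨D, hD⟩ : ∃ D : ℝ, D = 1 + 2 * ∑ i, (‖b i‖ + |e i|) ^ 2 := ⟨_, rfl⟩
  have hD0 : 0 ≤ D := by rw [hD]; positivity
  obtain ⟨A, hA⟩ : ∃ A : ℝ, A = 2 * ∑ j, ‖conv (a j)‖ := ⟨_, rfl⟩
  have hA0 : 0 ≤ A := by rw [hA]; positivity
  refine ⟨(2 * d + (2 * d * ‖B‖ + 2 * (d * D) + 1) * (2 * (C * (1 + 2 * d)))) + 1,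
    max ρ₀ (max (2 * (d * A)) (2 * (C * (‖B‖ + 1 + 2 * d * ‖B‖ + 2 * (d * D))))), by positivity,
    fun ρ hρ u u₁ u₂ h₁ h₂ => ?_⟩
  have hρ1 : ρ₀ ≤ ρ := (le_max_left _ _).trans hρ
  have hρ2 := (le_max_left _ _).trans ((le_max_right _ _).trans hρ)
  have hρ3 := (le_max_right _ _).trans ((le_max_right _ _).trans hρ)
  have hρ4 : 1 ≤ ρ := hρ₀.trans hρ1
  have h3 := H ρ hρ1 u u₁ u₂ h₁ h₂ u (fun n => le_rfl) (fun n hn => absurd (Set.mem_univ _) hn)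
  have h4 := norm_sum_square_le (fun j => conv (a j)) u₁ u₂
  rw [← hA] at h4
  have h5 : ∀ j, ρ * ‖u₁ j‖ ≤ ‖∑ j, u₂ j‖ + D * ρ ^ 2 * ‖u‖ := fun j => by
    have := norm_le_mul_add_mul (f := ((ρ : ℝ) : ℂ) • u₁ j) (g := ∑ j, u₂ j) (h := u)
      zero_le_one (by positivity : 0 ≤ D * ρ ^ 2) fun n => by
        rw [norm_ofReal_smul_apply, abs_of_nonneg (by linarith), sum_square_apply h₁ h₂ n, h₁,
          norm_mul, norm_mul, one_mul, ← mul_assoc, ← add_mul, hD]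
        exact mul_le_mul_of_nonneg_right (norm_symb_mul_le hρ4 j n) (norm_nonneg _)
    rwa [norm_ofReal_smul, one_mul, abs_of_nonneg (by linarith)] at this
  have h6 : ρ * ∑ j, ‖u₁ j‖ ≤ d * (‖∑ j, u₂ j‖ + D * ρ ^ 2 * ‖u‖) := by
    rw [Finset.mul_sum]
    refine (Finset.sum_le_sum fun j _ => h5 j).trans (le_of_eq ?_)
    rw [Finset.sum_const, Finset.card_univ, Fintype.card_fin, nsmul_eq_mul]
  have h7 : ‖∑ j, u₂ j + (2 : ℂ) • ∑ j, conv (a j) (u₁ j)‖ ≤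
      ‖∑ j, u₂ j + (2 : ℂ) • ∑ j, conv (a j) (u₁ j) + B u‖ + ‖B‖ * ‖u‖ := by
    refine (norm_le_add_norm_add _ (B u)).trans (add_le_add le_rfl ?_)
    exact ContinuousLinearMap.le_opNorm _ _
  have hW := norm_nonneg (∑ j, u₂ j + (2 : ℂ) • ∑ j, conv (a j) (u₁ j) + B u)
  have h8 : ρ * ∑ j, ‖u₁ j‖ ≤
      d * (‖∑ j, u₂ j + (2 : ℂ) • ∑ j, conv (a j) (u₁ j)‖ + A * ∑ j, ‖u₁ j‖) +
        (d * D) * ρ ^ 2 * ‖u‖ := by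
    have hd : (0 : ℝ) ≤ d := Nat.cast_nonneg d
    have := mul_le_mul_of_nonneg_left h4 hd
    linarith
  have := absorb_arith hC (by positivity) (Nat.cast_nonneg d) (norm_nonneg B) (norm_nonneg u)
    (Finset.sum_nonneg fun j _ => norm_nonneg _) h7 h3 h8 hρ4 hρ2 hρ3 hW
  refine this.trans (mul_le_mul_of_nonneg_right ?_ hW)
  linarith

end SeqL2

/-! ### Weighted summability of Fourier coefficients -/

theorem summable_norm_rpow_neg (d : ℕ) {p : ℝ} (hp : (d : ℝ) < p) :
    Summable fun m : Fin d → ℤ => ‖m‖ ^ (-p) := by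
  let bas := Pi.basisFun ℝ (Fin d)
  let L := Submodule.span ℤ (Set.range bas)
  have hr : Module.finrank ℤ L = d := by
    rw [ZLattice.rank ℝ L]; simp
  have hs := ZLattice.summable_norm_rpow L (-p) (by rw [hr]; linarith)
  let φ : (Fin d → ℤ) → L := fun m => ⟨fun j => (m j : ℝ), by
    refine (bas.mem_span_iff_repr_mem ℤ _).2 fun j => ?_
    exact ⟨m j, by simp [bas]⟩⟩
  have hφ : Function.Injective φ := fun m m' h => by
    ext j
    have : (m j : ℝ) = (m' j : ℝ) := congrFun (congrArg Subtype.val h) j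
    exact_mod_cast this
  have := hs.comp_injective hφ
  refine this.congr fun m => ?_
  have : ‖φ m‖ = ‖m‖ := by
    change ‖(fun j => (m j : ℝ))‖ = ‖m‖
    apply le_antisymm
    · refine (pi_norm_le_iff_of_nonneg (norm_nonneg _)).2 fun j => ?_
      have := norm_le_pi_norm m j
      rwa [Int.norm_eq_abs, ← Real.norm_eq_abs] at this
    · refine (pi_norm_le_iff_of_nonneg (norm_nonneg _)).2 fun j => ?_
      have := norm_le_pi_norm (fun j => (m j : ℝ)) j
      rwa [Int.norm_eq_abs, ← Real.norm_eq_abs]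
  rw [Function.comp_apply, this]

theorem freqSq_nonneg {d : ℕ} (n : Fin d → ℤ) : 0 ≤ freqSq n :=
  Finset.sum_nonneg fun _ _ => sq_nonneg _

theorem norm_sq_le_freqSq {d : ℕ} (n : Fin d → ℤ) : ‖n‖ ^ 2 ≤ freqSq n := by
  rcases isEmpty_or_nonempty (Fin d) with h | h
  · simp [freqSq, Subsingleton.elim n 0]
  obtain ⟨j, hj⟩ := Finite.exists_max fun j => ‖n j‖
  have h1 : ‖n‖ ≤ ‖n j‖ := (pi_norm_le_iff_of_nonneg (norm_nonneg _)).2 hj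
  have h2 : (n j : ℝ) ^ 2 ≤ freqSq n :=
    Finset.single_le_sum (f := fun i => (n i : ℝ) ^ 2) (fun _ _ => sq_nonneg _) (Finset.mem_univ j)
  rw [Int.norm_eq_abs] at h1
  refine le_trans ?_ h2
  rw [← sq_abs (n j : ℝ)]
  exact pow_le_pow_left₀ (norm_nonneg _) h1 2

/-- Weighted summability of the coefficients of a Sobolev function. -/
theorem summable_norm_rpow_mul_of_sobolev {d : ℕ} {s r : ℝ} (hr : 0 ≤ r)
    (hs : (d : ℝ) / 2 + r < s) {a : (Fin d → ℤ) → ℂ}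
    (ha : Summable fun n => (1 + freqSq n) ^ s * ‖a n‖ ^ 2) :
    Summable fun n => (1 + ‖n‖) ^ r * ‖a n‖ := by
  have h2 : Summable fun n : Fin d → ℤ => (1 + freqSq n) ^ (r - s) := by
    refine Summable.of_norm_bounded_eventually
      (summable_norm_rpow_neg d (p := 2 * (s - r)) (by linarith)) ?_
    filter_upwards [(Set.finite_singleton (0 : Fin d → ℤ)).compl_mem_cofinite] with n hn
    have hn0 : 0 < ‖n‖ := norm_pos_iff.2 hn
    rw [Real.norm_of_nonneg (Real.rpow_nonneg (by linarith [freqSq_nonneg n]) _)]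
    have e1 : ‖n‖ ^ (-(2 * (s - r))) = (‖n‖ ^ 2) ^ (r - s) := by
      rw [← Real.rpow_natCast, ← Real.rpow_mul hn0.le]
      congr 1; push_cast; ring
    rw [e1]
    exact Real.rpow_le_rpow_of_nonpos (by positivity) (by linarith [norm_sq_le_freqSq n])
      (by linarith [Nat.cast_nonneg (α := ℝ) d])
  refine Summable.of_nonneg_of_le (fun n => by positivity) (fun n => ?_)
    ((ha.add h2).mul_left ((2 : ℝ) ^ r))
  set x := 1 + freqSq n with hx
  have hx1 : 1 ≤ x := by linarith [freqSq_nonneg n]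
  have hx0 : 0 < x := by linarith
  have e2 : (1 + ‖n‖) ^ r ≤ 2 ^ r * x ^ (r / 2) := by
    have : 1 + ‖n‖ ≤ 2 * Real.sqrt x := by
      have h3 : 1 ≤ Real.sqrt x := Real.one_le_sqrt.2 hx1
      have h4 : ‖n‖ ≤ Real.sqrt x := Real.le_sqrt_of_sq_le (by linarith [norm_sq_le_freqSq n])
      linarith
    calc (1 + ‖n‖) ^ r ≤ (2 * Real.sqrt x) ^ r := Real.rpow_le_rpow (by positivity) this hr
      _ = 2 ^ r * x ^ (r / 2) := by
        rw [Real.mul_rpow (by norm_num) (Real.sqrt_nonneg _), Real.sqrt_eq_rpow,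
          ← Real.rpow_mul hx0.le]
        congr 2; ring
  -- The product of `x ^ (s/2) ‖a n‖` and `x ^ ((r-s)/2)`, bounded by the sum of their squares. Both
  -- squares are summable, the second because `2(s - r) > d`.
  have e3 : x ^ (r / 2) * ‖a n‖ ≤ x ^ s * ‖a n‖ ^ 2 + x ^ (r - s) := by
    have f1 : x ^ s = (x ^ (s / 2)) ^ 2 := by
      rw [← Real.rpow_natCast, ← Real.rpow_mul hx0.le]; congr 1; push_cast; ring
    have f2 : x ^ (r - s) = (x ^ ((r - s) / 2)) ^ 2 := by
      rw [← Real.rpow_natCast, ← Real.rpow_mul hx0.le]; congr 1; push_cast; ring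
    have f3 : x ^ (r / 2) = x ^ (s / 2) * x ^ ((r - s) / 2) := by
      rw [← Real.rpow_add hx0]; congr 1; ring
    rw [f1, f2, f3]
    nlinarith [sq_nonneg (x ^ (s / 2) * ‖a n‖ - x ^ ((r - s) / 2)),
      sq_nonneg (x ^ (s / 2) * ‖a n‖), sq_nonneg (x ^ ((r - s) / 2))]
  calc (1 + ‖n‖) ^ r * ‖a n‖ ≤ 2 ^ r * x ^ (r / 2) * ‖a n‖ := by gcongr
    _ = 2 ^ r * (x ^ (r / 2) * ‖a n‖) := by ring
    _ ≤ _ := by gcongr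

/-! ### Arithmetic of the shift and of the direction -/

theorem one_le_abs_of_half_le_abs_sin {x : ℝ} (h : 1 / 2 ≤ |Real.sin (x / 2)|) (k : ℤ) :
    1 ≤ |2 * Real.pi * k + x| := by
  have h1 : |Real.sin (x / 2 + k * Real.pi)| = |Real.sin (x / 2)| := by
    rw [Real.sin_add_int_mul_pi, abs_mul, abs_zpow, abs_neg, abs_one, one_zpow, one_mul]
  have h2 : |Real.sin (x / 2 + k * Real.pi)| ≤ |x / 2 + k * Real.pi| := Real.abs_sin_le_abs
  have h3 : |2 * Real.pi * k + x| = 2 * |x / 2 + k * Real.pi| := by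
    rw [← abs_two, ← abs_mul, abs_two]; congr 1; ring
  linarith

/-- Either `|sin(h/2)|` or `|cos(h/2)|` is at least `1/2`; accordingly `t = 0` or `t = π` works for
both signs of `h`. -/
theorem exists_avoiding_shift (h : ℝ) :
    ∃ t : ℝ, ∀ k : ℤ, 1 ≤ |2 * Real.pi * k + t + h| ∧ 1 ≤ |2 * Real.pi * k + t - h| := by
  by_cases hs : 1 / 2 ≤ |Real.sin (h / 2)|
  · refine ⟨0, fun k => ⟨?_, ?_⟩⟩
    · simpa using one_le_abs_of_half_le_abs_sin hs k
    · have := one_le_abs_of_half_le_abs_sin (x := -h) (by rwa [neg_div, Real.sin_neg, abs_neg]) k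
      simpa [sub_eq_add_neg] using this
  · have hc : 1 / 2 ≤ |Real.cos (h / 2)| := by
      by_contra hc
      have h1 := Real.sin_sq_add_cos_sq (h / 2)
      rw [← sq_abs (Real.sin _), ← sq_abs (Real.cos _)] at h1
      nlinarith [abs_nonneg (Real.sin (h / 2)), abs_nonneg (Real.cos (h / 2))]
    refine ⟨Real.pi, fun k => ⟨?_, ?_⟩⟩
    · have := one_le_abs_of_half_le_abs_sin (x := Real.pi + h) (by
        rwa [add_div, add_comm, Real.sin_add_pi_div_two]) k
      rwa [← add_assoc] at this
    · have := one_le_abs_of_half_le_abs_sin (x := Real.pi - h) (by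
        rwa [sub_div, Real.sin_pi_div_two_sub]) k
      rwa [← add_sub_assoc] at this

/-- If `m i` is the first nonzero coordinate, all later terms are divisible by `N ^ (i + 1)`. Hence
`N` divides `m i`. -/
theorem le_norm_of_geometric_orthogonal {d N : ℕ} (hN : 1 ≤ N) {m : Fin d → ℤ} (hm : m ≠ 0)
    (h : ∑ j : Fin d, (N : ℤ) ^ (j : ℕ) * m j = 0) : (N : ℝ) ≤ ‖m‖ := by
  classical
  have hne : (Finset.univ.filter fun j => m j ≠ 0).Nonempty := by
    obtain ⟨j, hj⟩ := Function.ne_iff.1 hm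
    exact ⟨j, by simpa using hj⟩
  set i := (Finset.univ.filter fun j => m j ≠ 0).min' hne with hi
  have hmi : m i ≠ 0 := (Finset.mem_filter.1 (Finset.min'_mem _ hne)).2
  have hlt : ∀ j, j < i → m j = 0 := fun j hj => by
    by_contra hj'
    exact absurd (Finset.min'_le _ j (by simpa using hj')) (not_le.2 hj)
  have hdvd : (N : ℤ) ^ ((i : ℕ) + 1) ∣ (N : ℤ) ^ (i : ℕ) * m i := by
    rw [← Finset.add_sum_erase _ _ (Finset.mem_univ i)] at h
    rw [eq_neg_of_add_eq_zero_left h]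
    refine (dvd_neg).2 (Finset.dvd_sum fun j hj => ?_)
    rcases lt_or_gt_of_ne (Finset.ne_of_mem_erase hj) with hji | hji
    · rw [hlt j hji, mul_zero]; exact dvd_zero _
    · exact Dvd.dvd.mul_right (pow_dvd_pow _ hji) _
  have hN0 : (N : ℤ) ^ (i : ℕ) ≠ 0 := pow_ne_zero _ (by exact_mod_cast (by omega : N ≠ 0))
  rw [pow_succ] at hdvd
  have h1 : (N : ℤ) ∣ m i := Int.dvd_of_mul_dvd_mul_left hN0 hdvd
  have h2 : (N : ℤ) ≤ |m i| := Int.le_of_dvd (abs_pos.2 hmi) ((dvd_abs _ _).2 h1)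
  have h3 := norm_le_pi_norm m i
  rw [Int.norm_eq_abs] at h3
  refine le_trans ?_ h3
  exact_mod_cast h2

theorem Summable.exists_forall_tail_le {ι : Type*} [DecidableEq ι] {g : ι → ℝ} (hg : Summable g)
    {ε : ℝ} (hε : 0 < ε) : ∃ S₀ : Finset ι, ∀ S, S₀ ⊆ S →
      Summable (fun m => if m ∈ S then 0 else g m) ∧ ∑' m, (if m ∈ S then 0 else g m) ≤ ε := by
  have h1 : ∀ S : Finset ι, HasSum (fun m => if m ∈ S then 0 else g m)
      (∑' m, g m - ∑ m ∈ S, g m) := fun S => by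
    have h2 : HasSum (fun m => if m ∈ S then g m else 0) (∑ m ∈ S, g m) := by
      have := hasSum_sum_of_ne_finset_zero (L := SummationFilter.unconditional ι) (f := fun m => if m ∈ S then g m else 0)
        (s := S) (fun m hm => if_neg hm)
      rwa [Finset.sum_congr rfl fun m hm => if_pos hm] at this
    have h4 : (fun m => if m ∈ S then 0 else g m) = fun m => g m - if m ∈ S then g m else 0 := by
      ext m; split_ifs <;> simp
    rw [h4]
    exact hg.hasSum.sub h2
  have h3 := (Metric.tendsto_nhds.1 hg.hasSum) ε hε
  obtain ⟨S₀, hS₀⟩ := Filter.eventually_atTop.1 h3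
  refine ⟨S₀, fun S hS => ⟨(h1 S).summable, ?_⟩⟩
  rw [(h1 S).tsum_eq]
  have := hS₀ S hS
  rw [Real.dist_eq] at this
  linarith [neg_abs_le (∑ m ∈ S, g m - ∑' m, g m)]

/-- An uncancelled mode either lies outside the large finite set `S'`, chosen after `N`, or is
orthogonal to the direction. In the latter case `N ≤ ‖m‖`, and the factor `N ^ (d - 1)` is absorbed
by the weight `‖m‖ ^ (d - 1)`. The mode `m = 0` is orthogonal to every direction, hence `h0`. -/
theorem exists_direction {d : ℕ} {a : Fin d → (Fin d → ℤ) → ℂ}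
    (h0 : ∀ j, a j 0 = 0) (ha : ∀ j, Summable fun m => ‖a j m‖)
    (ha' : ∀ j, Summable fun m => ‖m‖ ^ (d - 1) * ‖a j m‖) {ε : ℝ} (hε : 0 < ε) :
    ∃ (N : ℕ) (F : Finset (Fin d → ℤ)), 1 ≤ N ∧
      (∀ m ∈ F, ∑ j : Fin d, (N : ℝ) ^ (j : ℕ) * (m j : ℝ) ≠ 0) ∧
      (N : ℝ) ^ (d - 1) * ∑ j, ∑' m, (if m ∈ F then 0 else ‖a j m‖) ≤ ε := by
  classical
  set A : (Fin d → ℤ) → ℝ := fun m => ∑ j, ‖a j m‖ with hA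
  set g : (Fin d → ℤ) → ℝ := fun m => ∑ j, ‖m‖ ^ (d - 1) * ‖a j m‖ with hg
  have sA : Summable A := summable_sum fun j _ => ha j
  have sg : Summable g := summable_sum fun j _ => ha' j
  have hgA : ∀ m, g m = ‖m‖ ^ (d - 1) * A m := fun m => by rw [hg, hA, Finset.mul_sum]
  have hA0 : ∀ m, 0 ≤ A m := fun m => Finset.sum_nonneg fun j _ => norm_nonneg _
  obtain ⟨S, hS⟩ := sg.exists_forall_tail_le (half_pos hε)
  obtain ⟨hS1, hS2⟩ := hS S subset_rfl
  -- Every mode of norm at least `N` is then outside `S`, in the tail of the weighted sum.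
  obtain ⟨N, hN1, hN⟩ : ∃ N : ℕ, 1 ≤ N ∧ ∀ m ∈ S, ‖m‖ < N := by
    obtain ⟨M, hM⟩ := exists_nat_gt (∑ m ∈ S, ‖m‖)
    refine ⟨M + 1, by omega, fun m hm => ?_⟩
    have := Finset.single_le_sum (f := fun m : Fin d → ℤ => ‖m‖) (fun _ _ => norm_nonneg _) hm
    push_cast
    linarith
  have hN0 : (0 : ℝ) < N := by exact_mod_cast hN1
  set Γ := (N : ℝ) ^ (d - 1) with hΓ
  have hΓ0 : 0 < Γ := by positivity
  obtain ⟨S', hS'⟩ := sA.exists_forall_tail_le (div_pos (half_pos hε) hΓ0)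
  obtain ⟨hS'1, hS'2⟩ := hS' S' subset_rfl
  set F := S'.filter fun m => ∑ j : Fin d, (N : ℝ) ^ (j : ℕ) * (m j : ℝ) ≠ 0 with hF
  have sF : ∀ j, Summable fun m => if m ∈ F then 0 else ‖a j m‖ := fun j =>
    (ha j).of_nonneg_of_le (fun m => by split_ifs <;> simp) fun m => by split_ifs <;> simp
  refine ⟨N, F, hN1, fun m hm => (Finset.mem_filter.1 hm).2, ?_⟩
  rw [← Summable.tsum_finsetSum fun j _ => sF j, ← tsum_mul_left]
  have hpt : ∀ m, Γ * ∑ j, (if m ∈ F then 0 else ‖a j m‖) ≤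
      Γ * (if m ∈ S' then 0 else A m) + (if m ∈ S then 0 else g m) := fun m => by
    have hg0 : 0 ≤ g m := by rw [hgA]; exact mul_nonneg (by positivity) (hA0 m)
    by_cases hmF : m ∈ F
    · simp only [if_pos hmF, Finset.sum_const_zero, mul_zero]
      split_ifs <;> positivity
    · simp only [if_neg hmF]
      change Γ * A m ≤ _
      by_cases hmS' : m ∈ S'
      · rw [if_pos hmS', mul_zero, zero_add]
        by_cases hm0 : m = 0
        · have : A m = 0 := by simp [hA, hm0, h0]
          rw [this, mul_zero]; split_ifs <;> simp [hg0]
        have horth : ∑ j : Fin d, (N : ℝ) ^ (j : ℕ) * (m j : ℝ) = 0 := by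
          by_contra hne
          exact hmF (Finset.mem_filter.2 ⟨hmS', hne⟩)
        have hle := le_norm_of_geometric_orthogonal hN1 hm0 (by exact_mod_cast horth)
        rw [if_neg fun hmS => absurd (hN m hmS) (not_lt.2 hle), hgA]
        exact mul_le_mul_of_nonneg_right (pow_le_pow_left₀ hN0.le hle _) (hA0 m)
      · rw [if_neg hmS']
        have : (0 : ℝ) ≤ if m ∈ S then 0 else g m := by split_ifs <;> simp [hg0]
        linarith
  have sR := (hS'1.mul_left Γ).add hS1
  have sL := (summable_sum fun j (_ : j ∈ Finset.univ) => sF j).mul_left Γ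
  refine (Summable.tsum_le_tsum hpt sL sR).trans ?_
  rw [(hS'1.mul_left Γ).tsum_add hS1, tsum_mul_left]
  rw [le_div_iff₀ hΓ0] at hS'2
  linarith

/-! ### Lower bounds on the symbol and choice of parameters -/

namespace SeqL2

variable {d : ℕ}

theorem symb_re (b : Fin d → ℂ) (e : Fin d → ℝ) (ρ : ℝ) (j : Fin d) (n : Fin d → ℤ) :
    (symb b e ρ j n).re = 2 * Real.pi * n j + (b j).re := by
  simp [symb]

theorem symb_im (b : Fin d → ℂ) (e : Fin d → ℝ) (ρ : ℝ) (j : Fin d) (n : Fin d → ℤ) :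
    (symb b e ρ j n).im = (b j).im + ρ * e j := by
  simp [symb]

/-- With `E = Σ (1 + |e j|)`, one real part exceeds `(1 + E)ρ` while the imaginary parts have total
square at most `(Eρ)²`. So the real part of the sum is at least `((1 + E)² - E²)ρ² ≥ ρ²`. -/
theorem sq_le_norm_sum_symb_sq (b : Fin d → ℂ) (e : Fin d → ℝ) {ρ : ℝ}
    (hρ : 1 + ∑ j, ‖b j‖ ≤ ρ) (n : Fin d → ℤ)
    (hn : 2 + ∑ j, (1 + |e j|) < ‖scaledFreq ρ n‖) : ρ ^ 2 ≤ ‖∑ j, symb b e ρ j n ^ 2‖ := by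
  have hB : ∀ j, ‖b j‖ ≤ ρ := fun j => by
    have := Finset.single_le_sum (f := fun j => ‖b j‖) (fun _ _ => norm_nonneg _)
      (Finset.mem_univ j)
    linarith
  have hB0 : 0 ≤ ∑ j, ‖b j‖ := by positivity
  have hρ0 : 0 < ρ := by linarith
  set E := ∑ j, (1 + |e j|) with hE
  have hE0 : 0 ≤ E := by positivity
  obtain ⟨i, hi⟩ : ∃ i, 2 + E < ‖scaledFreq ρ n i‖ := by
    by_contra hcon
    push Not at hcon
    exact absurd hn (not_lt.2 ((pi_norm_le_iff_of_nonneg (by positivity)).2 hcon))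
  have h1 : (2 + E) * ρ < |2 * Real.pi * n i| := by
    rw [scaledFreq, norm_div, Real.norm_eq_abs, Real.norm_of_nonneg hρ0.le, lt_div_iff₀ hρ0] at hi
    exact hi
  have h2 : (1 + E) * ρ ≤ |(symb b e ρ i n).re| := by
    rw [symb_re]
    have e1 := abs_sub_abs_le_abs_sub (2 * Real.pi * n i) (-(b i).re)
    rw [abs_neg, sub_neg_eq_add] at e1
    have := (Complex.abs_re_le_norm (b i)).trans (hB i)
    linarith
  have h3 : ∀ j, |(symb b e ρ j n).im| ≤ (1 + |e j|) * ρ := fun j => by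
    rw [symb_im]
    refine (abs_add_le _ _).trans ?_
    rw [abs_mul, abs_of_pos hρ0]
    have := (Complex.abs_im_le_norm (b j)).trans (hB j)
    linarith
  have h4 : ∑ j, (symb b e ρ j n).im ^ 2 ≤ (E * ρ) ^ 2 := by
    have : ∑ j, (symb b e ρ j n).im ^ 2 ≤ ∑ j, ((1 + |e j|) * ρ) ^ 2 :=
      Finset.sum_le_sum fun j _ => by
        rw [← sq_abs]
        exact pow_le_pow_left₀ (abs_nonneg _) (h3 j) 2
    refine this.trans ?_
    rw [hE, Finset.sum_mul]
    exact Finset.sum_sq_le_sq_sum_of_nonneg fun j _ => by positivity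
  have h5 : ((1 + E) * ρ) ^ 2 ≤ ∑ j, (symb b e ρ j n).re ^ 2 := by
    have := Finset.single_le_sum (f := fun j => (symb b e ρ j n).re ^ 2)
      (fun _ _ => sq_nonneg _) (Finset.mem_univ i)
    refine le_trans ?_ this
    rw [← sq_abs (symb b e ρ i n).re]
    exact pow_le_pow_left₀ (by positivity) h2 2
  refine le_trans ?_ (Complex.re_le_norm _)
  have h6 : (∑ j, symb b e ρ j n ^ 2).re =
      ∑ j, (symb b e ρ j n).re ^ 2 - ∑ j, (symb b e ρ j n).im ^ 2 := by
    rw [Complex.re_sum, ← Finset.sum_sub_distrib]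
    exact Finset.sum_congr rfl fun j _ => by rw [pow_two, Complex.mul_re]; ring
  rw [h6]
  nlinarith [mul_nonneg hE0 (sq_nonneg ρ)]

/-- The choice of `β`: the symbol of the unperturbed operator is of size at least `ρ / 2`. -/
theorem exists_shift_le_norm_sum_symb_sq (hd : 2 ≤ d) (γ : Fin d → ℤ) (hγ : γ ≠ 0)
    (a₀ : Fin d → ℂ) (ha₀ : 3 ≤ d → ∀ j, (a₀ j).im = 0) :
    ∃ β ρ₁ : ℝ, 0 < β ∧ ∀ ρ, ρ₁ ≤ ρ → ∀ n : Fin d → ℤ,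
      1 / 2 * ρ ≤ ‖∑ j, symb (fun j => β * (γ j : ℂ) + a₀ j) (fun j => (γ j : ℝ)) ρ j n ^ 2‖ := by
  set q : ℝ := ∑ j, (γ j : ℝ) ^ 2 with hq
  have hq0 : 0 < q := by
    obtain ⟨j, hj⟩ := Function.ne_iff.1 hγ
    refine Finset.sum_pos' (fun _ _ => sq_nonneg _) ⟨j, Finset.mem_univ _, ?_⟩
    have : (γ j : ℝ) ≠ 0 := by exact_mod_cast hj
    positivity
  set α : ℝ := ∑ j, (a₀ j).re * γ j with hα
  -- Since `n·γ` is an integer, only `βq + α` modulo `2π` matters; a large multiple of `2π` makes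
  -- `β` positive.
  have key : ∀ t : ℝ, ∃ β > 0, ∃ l : ℤ, β * q + α = t + 2 * Real.pi * l := fun t => by
    obtain ⟨l, hl⟩ := exists_nat_gt (α - t)
    refine ⟨(t + 2 * Real.pi * l - α) / q, div_pos ?_ hq0, l, ?_⟩
    · have : (l : ℝ) ≤ 2 * Real.pi * l := by
        have := Real.pi_gt_three
        nlinarith [Nat.cast_nonneg (α := ℝ) l]
      linarith
    · rw [div_mul_cancel₀ _ hq0.ne']; push_cast; ring
  rcases hd.lt_or_eq with hd3 | rfl
  -- With a real mean the imaginary part of `Σ ζ_j²` is `2ρ` times a number kept at distance at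
  -- least `1` from zero. An imaginary mean would add a term growing with `n`.
  · obtain ⟨t, ht⟩ := exists_avoiding_shift 0
    obtain ⟨β, hβ, l, hl⟩ := key t
    refine ⟨β, 0, hβ, fun ρ hρ n => ?_⟩
    refine le_trans ?_ (Complex.abs_im_le_norm _)
    have h1 : (∑ j, symb (fun j => β * (γ j : ℂ) + a₀ j) (fun j => (γ j : ℝ)) ρ j n ^ 2).im =
        2 * ρ * (2 * Real.pi * ((∑ j, n j * γ j + l : ℤ) : ℝ) + t + 0) := by
      have e1 : 2 * Real.pi * ((∑ j, n j * γ j + l : ℤ) : ℝ) + t + 0 =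
          2 * Real.pi * (∑ j, (n j : ℝ) * γ j) + β * q + α := by push_cast; linarith
      rw [e1, Complex.im_sum, hq, hα, Finset.mul_sum, Finset.mul_sum, ← Finset.sum_add_distrib,
        ← Finset.sum_add_distrib, Finset.mul_sum]
      refine Finset.sum_congr rfl fun j _ => ?_
      rw [pow_two, Complex.mul_im, symb_re, symb_im]
      simp only [Complex.add_re, Complex.add_im, Complex.re_ofReal_mul, Complex.im_ofReal_mul,
        Complex.intCast_re, Complex.intCast_im, ha₀ hd3 j]
      ring
    rw [h1, abs_mul, abs_of_nonneg (by positivity)]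
    have := (ht (∑ j, n j * γ j + l)).1
    nlinarith
  · obtain ⟨t, ht⟩ := exists_avoiding_shift (-(a₀ 0).im * γ 1 + (a₀ 1).im * γ 0)
    obtain ⟨β, hβ, l, hl⟩ := key t
    set σ := (a₀ 0).im * γ 0 + (a₀ 1).im * γ 1 with hσ
    refine ⟨β, 2 * |σ| / q, hβ, fun ρ hρ n => ?_⟩
    rw [div_le_iff₀ hq0] at hρ
    have hk := ht (n 0 * γ 0 + n 1 * γ 1 + l)
    rw [Fin.sum_univ_two] at hq hα ⊢
    set ζ := fun j => symb (fun j => β * (γ j : ℂ) + a₀ j) (fun j => (γ j : ℝ)) ρ j n with hζ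
    have hre : ∀ j, (ζ j).re = 2 * Real.pi * n j + β * γ j + (a₀ j).re := fun j => by
      simp [hζ, symb_re, add_assoc]
    have him : ∀ j, (ζ j).im = (a₀ j).im + ρ * γ j := fun j => by simp [hζ, symb_im]
    change _ ≤ ‖ζ 0 ^ 2 + ζ 1 ^ 2‖
    -- In dimension two `q Σ ζ_j²` factors as `(ζ·γ + iζ·γ^⊥)(ζ·γ - iζ·γ^⊥)` with `γ^⊥ = (-γ 1, γ
    -- 0)`. In `ζ·γ^⊥` the parameter `ρ` cancels, so a complex mean merely shifts the two real parts
    -- by opposite amounts.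
    set P := (ζ 0 * γ 0 + ζ 1 * γ 1) + Complex.I * (-ζ 0 * γ 1 + ζ 1 * γ 0) with hP
    set Q := (ζ 0 * γ 0 + ζ 1 * γ 1) - Complex.I * (-ζ 0 * γ 1 + ζ 1 * γ 0) with hQ
    have hPQ : P * Q = (q : ℂ) * (ζ 0 ^ 2 + ζ 1 ^ 2) := by
      rw [hP, hQ, hq]
      push_cast
      linear_combination (-(-ζ 0 * γ 1 + ζ 1 * γ 0) ^ 2) * Complex.I_sq
    have hPre : P.re = 2 * Real.pi * ((n 0 * γ 0 + n 1 * γ 1 + l : ℤ) : ℝ) + t -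
        (-(a₀ 0).im * γ 1 + (a₀ 1).im * γ 0) := by
      simp [hP, hre, him]
      linear_combination hl - β * hq - hα
    have hQre : Q.re = 2 * Real.pi * ((n 0 * γ 0 + n 1 * γ 1 + l : ℤ) : ℝ) + t +
        (-(a₀ 0).im * γ 1 + (a₀ 1).im * γ 0) := by
      simp [hQ, hre, him]
      linear_combination hl - β * hq - hα
    have hIm : P.im + Q.im = 2 * (ρ * q + σ) := by
      simp [hP, hQ, hre, him]
      linear_combination -2 * ρ * hq - 2 * hσ
    have hP1 : 1 ≤ ‖P‖ := by
      refine le_trans ?_ (Complex.abs_re_le_norm P); rw [hPre]; exact hk.2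
    have hQ1 : 1 ≤ ‖Q‖ := by
      refine le_trans ?_ (Complex.abs_re_le_norm Q); rw [hQre]; exact hk.1
    have hs : 2 * (1 / 2 * ρ * q) ≤ ‖P‖ + ‖Q‖ := by
      have h1 := Complex.im_le_norm P
      have h2 := Complex.im_le_norm Q
      have h3 := neg_abs_le σ
      linarith
    -- Both factors have modulus at least `1`, and by `hs` one of them has modulus at least `ρq/2`.
    have hprod : 1 / 2 * ρ * q ≤ ‖P‖ * ‖Q‖ := by
      rcases le_total (1 / 2 * ρ * q) ‖P‖ with h | h
      · nlinarith
      · nlinarith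
    rw [← norm_mul, hPQ, norm_mul, Complex.norm_real, Real.norm_of_nonneg hq0.le, mul_comm q] at hprod
    exact le_of_mul_le_mul_right hprod hq0

/-- Choice of all parameters in the a priori estimate. -/
theorem exists_parameters_estimate (hd : 2 ≤ d) {a : Fin d → (Fin d → ℤ) → ℂ}
    (ha : ∀ j, Summable fun m => (1 + ‖m‖) ^ (d - 1) * ‖a j m‖)
    (ha₀ : 3 ≤ d → ∀ j, (a j 0).im = 0) (B : Op (Fin d → ℤ)) :
    ∃ (γ : Fin d → ℤ) (β C ρ₀ : ℝ), 0 < β ∧ 0 < C ∧ ∀ ρ, ρ₀ ≤ ρ → ∀ (u : SeqL2 (Fin d → ℤ))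
      (u₁ u₂ : Fin d → SeqL2 (Fin d → ℤ)),
      (∀ j n, u₁ j n =
        symb (fun j => β * (γ j : ℂ) + a j 0) (fun j => (γ j : ℝ)) ρ j n * u n) →
      (∀ j n, u₂ j n =
        symb (fun j => β * (γ j : ℂ) + a j 0) (fun j => (γ j : ℝ)) ρ j n * u₁ j n) →
      ρ * ‖u‖ + ∑ j, ‖u₁ j‖ ≤ C * ‖∑ j, u₂ j +
        (2 : ℂ) • ∑ j, conv (Function.update (a j) 0 0) (u₁ j) + B u‖ := by
  classical
  set a' : Fin d → (Fin d → ℤ) → ℂ := fun j => Function.update (a j) 0 0 with ha'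
  have hle : ∀ j m, ‖a' j m‖ ≤ ‖a j m‖ := fun j m => by
    by_cases hm : m = 0
    · subst hm; simp [ha']
    · simp [ha', hm]
  have h0 : ∀ j, a' j 0 = 0 := fun j => by simp [ha']
  have hone : ∀ m : Fin d → ℤ, (1 : ℝ) ≤ 1 + ‖m‖ := fun m => by linarith [norm_nonneg m]
  have s0 : ∀ j, Summable fun m => ‖a' j m‖ := fun j =>
    (ha j).of_nonneg_of_le (fun _ => norm_nonneg _) fun m => (hle j m).trans
      (le_mul_of_one_le_left (norm_nonneg _) (one_le_pow₀ (hone m)))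
  have s1 : ∀ j, Summable fun m => ‖a' j m‖ * ‖m‖ := fun j =>
    (ha j).of_nonneg_of_le (fun _ => by positivity) fun m => by
      rw [mul_comm]
      refine mul_le_mul ?_ (hle j m) (norm_nonneg _) (by positivity)
      calc ‖m‖ ≤ (1 + ‖m‖) ^ 1 := by simp
        _ ≤ _ := pow_le_pow_right₀ (hone m) (by omega)
  have sd : ∀ j, Summable fun m => ‖m‖ ^ (d - 1) * ‖a' j m‖ := fun j =>
    (ha j).of_nonneg_of_le (fun _ => by positivity) fun m =>
      mul_le_mul (pow_le_pow_left₀ (norm_nonneg _) (by linarith) _) (hle j m) (norm_nonneg _)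
        (by positivity)
  have hd0 : (0 : ℝ) < d := by exact_mod_cast (by omega : 0 < d)
  -- Here `|z_j| ≤ R + Γ ≤ 5dΓ`, so the residual is at most `10d · ε = 1/8`, which is `c/4` for `c =
  -- 1/2`.
  obtain ⟨N, F, hN, hF, hres⟩ := exists_direction h0 s0 sd (ε := 1 / (80 * d)) (by positivity)
  have hN1 : (1 : ℝ) ≤ N := by exact_mod_cast hN
  set Γ : ℝ := (N : ℝ) ^ (d - 1) with hΓ
  have hΓ1 : 1 ≤ Γ := one_le_pow₀ hN1
  set γ : Fin d → ℤ := fun j => (N : ℤ) ^ (j : ℕ) with hγ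
  have hγ0 : γ ≠ 0 := fun h => by
    have := congrFun h ⟨0, by omega⟩
    simp [hγ] at this
  have hγle : ∀ j, |(γ j : ℝ)| ≤ Γ := fun j => by
    simp only [hγ]
    push_cast
    rw [abs_of_nonneg (by positivity)]
    exact pow_le_pow_right₀ hN1 (by omega)
  obtain ⟨β, ρ₁, hβ, hlow⟩ := exists_shift_le_norm_sum_symb_sq hd γ hγ0 (fun j => a j 0) ha₀
  set b : Fin d → ℂ := fun j => β * (γ j : ℂ) + a j 0 with hb
  set R := 2 + ∑ j, (1 + |(γ j : ℝ)|) with hR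
  have hRle : R ≤ 4 * d * Γ := by
    have h1 : ∑ j, (1 + |(γ j : ℝ)|) ≤ ∑ j : Fin d, (2 * Γ) :=
      Finset.sum_le_sum fun j _ => by linarith [hγle j]
    rw [Finset.sum_const, Finset.card_univ, Fintype.card_fin, nsmul_eq_mul] at h1
    have hd2 : (2 : ℝ) ≤ d := by exact_mod_cast hd
    nlinarith
  obtain ⟨C, ρ₀, hC, H⟩ := exists_estimate (b := b) (e := fun j => (γ j : ℝ)) (a := a') s0 s1
    (c := 1 / 2) (ρ₁ := max ρ₁ (1 + ∑ j, ‖b j‖)) (R := R) (by norm_num)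
    (fun ρ hρ n => hlow ρ ((le_max_left _ _).trans hρ) n)
    (fun ρ hρ n hn => sq_le_norm_sum_symb_sq b _ ((le_max_right _ _).trans hρ) n hn) F
    (fun m hm => by simpa [hγ] using hF m hm)
    (fun y hy => by
      have h1 : ∀ j, ‖(y j : ℂ) + Complex.I * (((γ j : ℝ)) : ℂ)‖ ≤ 5 * d * Γ := fun j => by
        refine (norm_add_le _ _).trans ?_
        rw [norm_mul, Complex.norm_I, one_mul, Complex.norm_real, Complex.norm_real]
        have h2 := (norm_le_pi_norm y j).trans (hy.trans hRle)
        have h3 := hγle j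
        rw [← Real.norm_eq_abs] at h3
        have hd1 : (1 : ℝ) ≤ d := by exact_mod_cast (by omega : 1 ≤ d)
        nlinarith
      calc 2 * ∑ j, ‖(y j : ℂ) + Complex.I * (((γ j : ℝ)) : ℂ)‖ *
            ∑' m, (if m ∈ F then 0 else ‖a' j m‖)
          ≤ 2 * ∑ j, (5 * d * Γ) * ∑' m, (if m ∈ F then 0 else ‖a' j m‖) := by
            refine mul_le_mul_of_nonneg_left (Finset.sum_le_sum fun j _ => ?_) (by norm_num)
            exact mul_le_mul_of_nonneg_right (h1 j)
              (tsum_nonneg fun m => by split_ifs <;> simp)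
        _ = 10 * d * (Γ * ∑ j, ∑' m, (if m ∈ F then 0 else ‖a' j m‖)) := by
            rw [← Finset.mul_sum]; ring
        _ ≤ 10 * d * (1 / (80 * d)) := mul_le_mul_of_nonneg_left hres (by positivity)
        _ = 1 / 2 / 4 := by field_simp; norm_num) B
  exact ⟨γ, β, C, ρ₀, hβ, hC, H⟩

end SeqL2

open SeqL2

/-! ### Passage between functions on the torus and coefficient sequences -/

section Fourier

variable {d : ℕ}

/-- The Fourier basis of `L₂(𝕋^d)`, with the measure written as `torusMeasure d`. -/
def torusBasis (d : ℕ) : HilbertBasis (Fin d → ℤ) ℂ (Lp ℂ 2 (torusMeasure d)) :=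
  UnitAddTorus.mFourierBasis

theorem torusBasis_repr (f : Lp ℂ 2 (torusMeasure d)) (n : Fin d → ℤ) :
    (torusBasis d).repr f n = UnitAddTorus.mFourierCoeff f n :=
  UnitAddTorus.mFourierBasis_repr f n

theorem mFourierCoeff_eq (f : UnitAddTorus (Fin d) → ℂ) (n : Fin d → ℤ) :
    UnitAddTorus.mFourierCoeff f n = ∫ t, UnitAddTorus.mFourier (-n) t * f t ∂(torusMeasure d) :=
  rfl

theorem mFourierCoeff_congr_ae {f g : UnitAddTorus (Fin d) → ℂ} (h : f =ᵐ[torusMeasure d] g)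
    (n : Fin d → ℤ) : UnitAddTorus.mFourierCoeff f n = UnitAddTorus.mFourierCoeff g n := by
  rw [mFourierCoeff_eq, mFourierCoeff_eq]
  refine integral_congr_ae ?_
  filter_upwards [h] with x hx
  rw [hx]

theorem exists_coeff {f : UnitAddTorus (Fin d) → ℂ} (hf : MemLp f 2 (torusMeasure d)) :
    ∃ F : SeqL2 (Fin d → ℤ), (∀ n, F n = UnitAddTorus.mFourierCoeff f n) ∧ ‖F‖ = l2Norm f := by
  refine ⟨(torusBasis d).repr (hf.toLp f), fun n => ?_, ?_⟩
  · rw [torusBasis_repr]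
    exact mFourierCoeff_congr_ae hf.coeFn_toLp n
  · rw [LinearIsometryEquiv.norm_map, Lp.norm_toLp, l2Norm]

theorem exists_fun (F : SeqL2 (Fin d → ℤ)) : ∃ f : UnitAddTorus (Fin d) → ℂ,
    MemLp f 2 (torusMeasure d) ∧ ∀ n, UnitAddTorus.mFourierCoeff f n = F n := by
  refine ⟨(torusBasis d).repr.symm F, Lp.memLp _, fun n => ?_⟩
  rw [← torusBasis_repr, LinearIsometryEquiv.apply_symm_apply]

theorem hasSum_parseval {f g : UnitAddTorus (Fin d) → ℂ} (hf : MemLp f 2 (torusMeasure d))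
    (hg : MemLp g 2 (torusMeasure d)) :
    HasSum (fun m => (starRingEnd ℂ) (UnitAddTorus.mFourierCoeff f m) *
      UnitAddTorus.mFourierCoeff g m) (∫ t, (starRingEnd ℂ) (f t) * g t ∂(torusMeasure d)) := by
  have h := UnitAddTorus.hasSum_prod_mFourierCoeff (d := Fin d) (hf.toLp f) (hg.toLp g)
  have h1 : ∀ m, UnitAddTorus.mFourierCoeff (hf.toLp f) m = UnitAddTorus.mFourierCoeff f m :=
    mFourierCoeff_congr_ae hf.coeFn_toLp
  have h2 : ∀ m, UnitAddTorus.mFourierCoeff (hg.toLp g) m = UnitAddTorus.mFourierCoeff g m :=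
    mFourierCoeff_congr_ae hg.coeFn_toLp
  simp only [h1, h2] at h
  convert h using 1
  change _ = ∫ t, _ ∂(torusMeasure d)
  refine integral_congr_ae ?_
  filter_upwards [hf.coeFn_toLp, hg.coeFn_toLp] with x hx hy
  rw [hx, hy]

/-- The Fourier coefficients of a product. -/
theorem mFourierCoeff_mul {A f : UnitAddTorus (Fin d) → ℂ} (hA : MemLp A 2 (torusMeasure d))
    (hf : MemLp f 2 (torusMeasure d)) (hs : Summable fun m => ‖UnitAddTorus.mFourierCoeff A m‖)
    {F : SeqL2 (Fin d → ℤ)} (hF : ∀ n, F n = UnitAddTorus.mFourierCoeff f n) (n : Fin d → ℤ) :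
    UnitAddTorus.mFourierCoeff (fun x => A x * f x) n =
      conv (fun m => UnitAddTorus.mFourierCoeff A m) F n := by
  -- Parseval is applied to `A` and this `g`, whose conjugated coefficients are the translated ones
  -- of `f`.
  set g : UnitAddTorus (Fin d) → ℂ := fun x => UnitAddTorus.mFourier n x * (starRingEnd ℂ) (f x)
    with hg
  have hgL : MemLp g 2 (torusMeasure d) := by
    refine MemLp.of_le hf ?_ (Filter.Eventually.of_forall fun x => ?_)
    · exact (ContinuousMap.continuous _).aestronglyMeasurable.mul
        (Complex.continuous_conj.comp_aestronglyMeasurable hf.1)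
    · rw [hg, norm_mul, RCLike.norm_conj]
      refine mul_le_of_le_one_left (norm_nonneg _) ?_
      exact (ContinuousMap.norm_coe_le_norm _ _).trans UnitAddTorus.mFourier_norm.le
  have hgc : ∀ m, (starRingEnd ℂ) (UnitAddTorus.mFourierCoeff g m) = F (n - m) := fun m => by
    rw [hF, mFourierCoeff_eq, mFourierCoeff_eq, ← integral_conj]
    refine integral_congr_ae (Filter.Eventually.of_forall fun x => ?_)
    simp only [hg, map_mul, Complex.conj_conj, UnitAddTorus.mFourier_neg, sub_eq_add_neg,
      neg_add_rev, neg_neg, UnitAddTorus.mFourier_add]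
    ring
  have h := hasSum_parseval hgL hA
  simp only [hgc] at h
  have h2 := hasSum_conv_apply hs F n
  simp only [mul_comm (F _)] at h
  rw [h2.unique h, mFourierCoeff_eq]
  refine integral_congr_ae (Filter.Eventually.of_forall fun x => ?_)
  simp only [hg, map_mul, Complex.conj_conj, UnitAddTorus.mFourier_neg]
  ring

/-- `IsMagneticSquare` in terms of Fourier coefficients. -/
theorem isMagneticSquare_iff {A : Fin d → UnitAddTorus (Fin d) → ℂ} (k : Fin d → ℂ)
    (hA : ∀ j, MemLp (A j) 2 (torusMeasure d))
    (hs : ∀ j, Summable fun m => ‖UnitAddTorus.mFourierCoeff (A j) m‖)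
    {u w : UnitAddTorus (Fin d) → ℂ} (hu : MemLp u 2 (torusMeasure d))
    {U : SeqL2 (Fin d → ℤ)} (hU : ∀ n, U n = UnitAddTorus.mFourierCoeff u n) :
    IsMagneticSquare A k u w ↔ MemLp w 2 (torusMeasure d) ∧ ∃ V : Fin d → SeqL2 (Fin d → ℤ),
      (∀ j n, V j n = (2 * (Real.pi : ℂ) * (n j : ℂ) + k j) * U n +
        conv (fun m => UnitAddTorus.mFourierCoeff (A j) m) U n) ∧
      ∀ n, UnitAddTorus.mFourierCoeff w n = ∑ j, ((2 * (Real.pi : ℂ) * (n j : ℂ) + k j) * V j n +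
        conv (fun m => UnitAddTorus.mFourierCoeff (A j) m) (V j) n) := by
  refine and_congr_right fun _ => ⟨?_, ?_⟩
  · rintro ⟨v, hv, hv1, hw⟩
    choose V hV _ using fun j => exists_coeff (hv j)
    refine ⟨V, fun j n => ?_, fun n => ?_⟩
    · rw [hV, hv1, momentumCoeff, mFourierCoeff_mul (hA j) hu (hs j) hU, hU]
    · rw [hw]
      refine Finset.sum_congr rfl fun j _ => ?_
      rw [momentumCoeff, mFourierCoeff_mul (hA j) (hv j) (hs j) (hV j), hV]
  · rintro ⟨V, hV, hw⟩
    choose v hv hv1 using fun j => exists_fun (V j)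
    refine ⟨v, hv, fun j n => ?_, fun n => ?_⟩
    · rw [hv1, hV, momentumCoeff, mFourierCoeff_mul (hA j) hu (hs j) hU, hU]
    · rw [hw]
      refine Finset.sum_congr rfl fun j _ => ?_
      rw [momentumCoeff, mFourierCoeff_mul (hA j) (hv j) (hs j) fun n => (hv1 j n).symm, hv1]

theorem norm_symb_sq_le (b : Fin d → ℂ) (e : Fin d → ℝ) (ρ : ℝ) (j : Fin d) :
    ∃ K : ℝ, 0 ≤ K ∧ ∀ n, ‖symb b e ρ j n‖ ^ 2 ≤ K * (1 + freqSq n) := by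
  refine ⟨2 * (2 * Real.pi) ^ 2 + 2 * (‖b j‖ + |ρ| * |e j|) ^ 2, by positivity, fun n => ?_⟩
  have h1 : ‖symb b e ρ j n‖ ≤ 2 * Real.pi * |(n j : ℝ)| + (‖b j‖ + |ρ| * |e j|) := by
    rw [symb, add_assoc]
    refine (norm_add_le _ _).trans (add_le_add (le_of_eq ?_) ((norm_add_le _ _).trans
      (add_le_add le_rfl (le_of_eq ?_))))
    · simp [abs_of_pos Real.pi_pos]
    · simp
  have h2 : (n j : ℝ) ^ 2 ≤ freqSq n :=
    Finset.single_le_sum (f := fun i => (n i : ℝ) ^ 2) (fun _ _ => sq_nonneg _) (Finset.mem_univ j)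
  have h3 := freqSq_nonneg n
  set c := ‖b j‖ + |ρ| * |e j|
  have h4 : ‖symb b e ρ j n‖ ^ 2 ≤ (2 * Real.pi * |(n j : ℝ)| + c) ^ 2 :=
    pow_le_pow_left₀ (norm_nonneg _) h1 2
  have h5 : (2 * Real.pi * |(n j : ℝ)|) ^ 2 = (2 * Real.pi) ^ 2 * (n j : ℝ) ^ 2 := by
    rw [mul_pow, sq_abs]
  have h6 := mul_le_mul_of_nonneg_left h2 (sq_nonneg (2 * Real.pi))
  nlinarith [sq_nonneg (2 * Real.pi * |(n j : ℝ)| - c), mul_nonneg (sq_nonneg c) h3,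
    sq_nonneg (2 * Real.pi)]

theorem exists_symb_mul {u : UnitAddTorus (Fin d) → ℂ} (hu : MemSobolev 2 u)
    {U : SeqL2 (Fin d → ℤ)} (hU : ∀ n, U n = UnitAddTorus.mFourierCoeff u n) (b : Fin d → ℂ)
    (e : Fin d → ℝ) (ρ : ℝ) : ∃ U₁ U₂ : Fin d → SeqL2 (Fin d → ℤ),
      (∀ j n, U₁ j n = symb b e ρ j n * U n) ∧ ∀ j n, U₂ j n = symb b e ρ j n * U₁ j n := by
  obtain ⟨G, hG⟩ := exists_of_summable (φ := fun n => ((1 + freqSq n : ℝ) : ℂ) * U n) (by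
    refine hu.2.congr fun n => ?_
    rw [norm_mul, Complex.norm_real, Real.norm_of_nonneg (by linarith [freqSq_nonneg n]), mul_pow,
      hU, Real.rpow_ofNat])
  have hGn : ∀ n, ‖G n‖ = (1 + freqSq n) * ‖U n‖ := fun n => by
    rw [hG, norm_mul, Complex.norm_real, Real.norm_of_nonneg (by linarith [freqSq_nonneg n])]
  choose K hK0 hK using norm_symb_sq_le b e ρ
  have h1 : ∀ j, ∃ f : SeqL2 (Fin d → ℤ), ∀ n, f n = symb b e ρ j n * U n := fun j =>
    exists_of_le (g := G) (C := 1 + K j) fun n => by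
      rw [norm_mul, hGn, ← mul_assoc]
      refine mul_le_mul_of_nonneg_right ?_ (norm_nonneg _)
      nlinarith [hK j n, sq_nonneg (‖symb b e ρ j n‖ - 1), freqSq_nonneg n]
  choose U₁ hU₁ using h1
  have h2 : ∀ j, ∃ f : SeqL2 (Fin d → ℤ), ∀ n, f n = symb b e ρ j n * U₁ j n := fun j =>
    exists_of_le (g := G) (C := K j) fun n => by
      rw [hU₁, ← mul_assoc, ← pow_two, norm_mul, hGn, ← mul_assoc, norm_pow]
      exact mul_le_mul_of_nonneg_right (hK j n) (norm_nonneg _)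
  choose U₂ hU₂ using h2
  exact ⟨U₁, U₂, hU₁, hU₂⟩

/-- The frequency is recovered from `2πn_j = ζ_j - (b_j + iρe_j)`, at the price of a multiple of
`ρ‖U‖`. -/
theorem sobolevNorm_one_le {u : UnitAddTorus (Fin d) → ℂ} (hu : MemSobolev 2 u)
    {U : SeqL2 (Fin d → ℤ)} (hU : ∀ n, U n = UnitAddTorus.mFourierCoeff u n) {b : Fin d → ℂ}
    {e : Fin d → ℝ} {ρ : ℝ} (hρ : 1 ≤ ρ) {U₁ : Fin d → SeqL2 (Fin d → ℤ)}
    (hU₁ : ∀ j n, U₁ j n = symb b e ρ j n * U n) :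
    sobolevNorm 1 u ≤ (1 + ∑ j, (‖b j‖ + |e j|)) * (ρ * ‖U‖) + ∑ j, ‖U₁ j‖ := by
  have hs1 : Summable fun n : Fin d → ℤ => ‖((Real.sqrt (1 + freqSq n) : ℝ) : ℂ) * U n‖ ^ 2 := by
    refine Summable.of_nonneg_of_le (fun n => by positivity) (fun n => ?_) hu.2
    have h0 := freqSq_nonneg n
    rw [norm_mul, Complex.norm_real, Real.norm_of_nonneg (Real.sqrt_nonneg _), mul_pow, hU,
      Real.sq_sqrt (by linarith), Real.rpow_ofNat]
    refine mul_le_mul_of_nonneg_right ?_ (sq_nonneg _)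
    nlinarith
  obtain ⟨G, hG⟩ := exists_of_summable hs1
  have hGs : sobolevNorm 1 u = ‖G‖ := by
    rw [sobolevNorm, ← Real.sqrt_sq (norm_nonneg G), norm_sq_eq]
    congr 1
    refine tsum_congr fun n => ?_
    rw [hG, norm_mul, Complex.norm_real, Real.norm_of_nonneg (Real.sqrt_nonneg _), mul_pow, hU,
      Real.sq_sqrt (by linarith [freqSq_nonneg n]), Real.rpow_one]
  set κ := (1 + ∑ j, (‖b j‖ + |e j|)) * ρ with hκ
  have hκ0 : 0 ≤ κ := by positivity
  have hpt : ∀ n, ‖G n‖ ≤ κ * ‖U n‖ + ∑ j, ‖U₁ j n‖ := fun n => by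
    rw [hG, norm_mul, Complex.norm_real, Real.norm_of_nonneg (Real.sqrt_nonneg _)]
    simp only [hU₁, norm_mul]
    rw [← Finset.sum_mul, ← add_mul]
    refine mul_le_mul_of_nonneg_right ?_ (norm_nonneg _)
    have h1 : Real.sqrt (1 + freqSq n) ≤ 1 + ∑ j, |(n j : ℝ)| := by
      refine Real.sqrt_le_iff.2 ⟨by positivity, ?_⟩
      have h2 : freqSq n ≤ (∑ j, |(n j : ℝ)|) ^ 2 := by
        have := Finset.sum_sq_le_sq_sum_of_nonneg (s := Finset.univ) (f := fun j => |(n j : ℝ)|)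
          fun j _ => abs_nonneg _
        simpa [freqSq] using this
      have : 0 ≤ ∑ j, |(n j : ℝ)| := by positivity
      nlinarith
    have h3 : ∀ j, |(n j : ℝ)| ≤ (‖b j‖ + |e j|) * ρ + ‖symb b e ρ j n‖ := fun j => by
      have h4 : 2 * (Real.pi : ℂ) * (n j : ℂ) =
        symb b e ρ j n - (b j + Complex.I * (ρ : ℂ) * (e j : ℂ)) := by rw [symb]; ring
      have h5 : ‖2 * (Real.pi : ℂ) * (n j : ℂ)‖ = 2 * Real.pi * |(n j : ℝ)| := by
        simp [abs_of_pos Real.pi_pos]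
      have h6 : ‖b j + Complex.I * (ρ : ℂ) * (e j : ℂ)‖ ≤ ‖b j‖ + ρ * |e j| := by
        refine (norm_add_le _ _).trans (add_le_add le_rfl (le_of_eq ?_))
        simp [abs_of_nonneg (zero_le_one.trans hρ)]
      have h7 := norm_sub_le (symb b e ρ j n) (b j + Complex.I * (ρ : ℂ) * (e j : ℂ))
      rw [← h4, h5] at h7
      have h8 := Real.pi_gt_three
      nlinarith [abs_nonneg (n j : ℝ), norm_nonneg (b j)]
    have h9 := Finset.sum_le_sum fun j (_ : j ∈ Finset.univ) => h3 j
    rw [Finset.sum_add_distrib, ← Finset.sum_mul] at h9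
    rw [hκ]
    linarith
  rw [hGs, ← mul_assoc, ← hκ]
  have hle : ‖G‖ ≤ ‖(κ : ℂ) • SeqL2.abs U + ∑ j, SeqL2.abs (U₁ j)‖ := by
    refine lp.norm_mono (by simp) fun n => ?_
    have : ((κ : ℂ) • SeqL2.abs U + ∑ j, SeqL2.abs (U₁ j)) n =
        ((κ * ‖U n‖ + ∑ j, ‖U₁ j n‖ : ℝ) : ℂ) := by
      rw [lp.coeFn_add, Pi.add_apply, lp.coeFn_smul, Pi.smul_apply, lp.coeFn_sum,
        Finset.sum_apply]
      simp [SeqL2.abs_apply]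
    rw [this, Complex.norm_real, Real.norm_of_nonneg (by positivity)]
    exact hpt n
  refine hle.trans ((norm_add_le _ _).trans (add_le_add ?_ (norm_sum_le_of_le _ fun j _ => ?_)))
  · rw [norm_ofReal_smul, norm_abs, abs_of_nonneg hκ0]
  · rw [norm_abs]

end Fourier

/-! ### The magnetic operator and the main estimates -/

section Main

variable {d : ℕ}

theorem symb_eq (β : ℝ) (e : Fin d → ℝ) (c : Fin d → ℂ) (ρ : ℝ) (j : Fin d) (n : Fin d → ℤ) :
    symb (fun j => (β : ℂ) * (e j : ℂ) + c j) e ρ j n =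
      2 * (Real.pi : ℂ) * (n j : ℂ) + ((β : ℂ) + Complex.I * (ρ : ℂ)) * (e j : ℂ) + c j := by
  rw [symb]; ring

theorem conv_eq_update_add {a : (Fin d → ℤ) → ℂ} (ha : Summable fun m => ‖a m‖)
    (U : SeqL2 (Fin d → ℤ)) (n : Fin d → ℤ) :
    conv a U n = conv (Function.update a 0 0) U n + a 0 * U n := by
  classical
  have h := (hasSum_conv_apply ha U n).update 0 0
  have h' : Summable fun m => ‖Function.update a 0 0 m‖ := by
    refine ha.of_nonneg_of_le (fun _ => norm_nonneg _) fun m => ?_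
    by_cases hm : m = 0
    · subst hm; simp
    · simp [hm]
  have h2 := hasSum_conv_apply h' U n
  have h3 : (fun m => Function.update a 0 0 m * U (n - m)) =
      Function.update (fun m => a m * U (n - m)) 0 0 := by
    ext m
    by_cases hm : m = 0
    · subst hm; simp
    · simp [hm]
  rw [h3] at h2
  have := h2.unique h
  rw [this]
  simp

/-- The magnetic square on the Fourier side, with the mean value of `A` put into the symbol. -/
theorem magnetic_square_expand {a : Fin d → (Fin d → ℤ) → ℂ}
    (ha : ∀ j, Summable fun m => ‖a j m‖) (ha' : ∀ j, Summable fun m => ‖m‖ * ‖a j m‖)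
    {β ρ : ℝ} {e : Fin d → ℝ} {U : SeqL2 (Fin d → ℤ)} {U₁ U₂ V : Fin d → SeqL2 (Fin d → ℤ)}
    (hU₁ : ∀ j n, U₁ j n = symb (fun j => (β : ℂ) * (e j : ℂ) + a j 0) e ρ j n * U n)
    (hU₂ : ∀ j n, U₂ j n = symb (fun j => (β : ℂ) * (e j : ℂ) + a j 0) e ρ j n * U₁ j n)
    (hV : ∀ j, V j = U₁ j + conv (Function.update (a j) 0 0) U) (n : Fin d → ℤ) :
    ∑ j, ((2 * (Real.pi : ℂ) * (n j : ℂ) + ((β : ℂ) + Complex.I * (ρ : ℂ)) * (e j : ℂ)) * V j n +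
        conv (a j) (V j) n) =
      (∑ j, U₂ j + (2 : ℂ) • ∑ j, conv (Function.update (a j) 0 0) (U₁ j) +
        (∑ j, (conv (fun m => 2 * (Real.pi : ℂ) * (m j : ℂ) * Function.update (a j) 0 0 m) +
          conv (Function.update (a j) 0 0) * conv (Function.update (a j) 0 0))) U) n := by
  classical
  have hle : ∀ j m, ‖Function.update (a j) 0 0 m‖ ≤ ‖a j m‖ := fun j m => by
    by_cases hm : m = 0
    · subst hm; simp
    · simp [hm]
  have h1 : ∀ j, Summable fun m => ‖Function.update (a j) 0 0 m‖ := fun j =>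
    (ha j).of_nonneg_of_le (fun _ => norm_nonneg _) (hle j)
  have h2 : ∀ j, Summable fun m : Fin d → ℤ =>
      ‖2 * (Real.pi : ℂ) * (m j : ℂ) * Function.update (a j) 0 0 m‖ := fun j =>
    ((ha' j).mul_left (2 * Real.pi)).of_nonneg_of_le (fun _ => norm_nonneg _) fun m => by
      have h3 : ‖2 * (Real.pi : ℂ) * (m j : ℂ)‖ ≤ 2 * Real.pi * ‖m‖ := by
        have := norm_le_pi_norm m j
        rw [Int.norm_eq_abs] at this
        have h4 : ‖2 * (Real.pi : ℂ) * (m j : ℂ)‖ = 2 * Real.pi * |(m j : ℝ)| := by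
          simp [abs_of_pos Real.pi_pos]
        rw [h4]
        gcongr
      rw [norm_mul, ← mul_assoc]
      exact mul_le_mul h3 (hle j m) (norm_nonneg _) (by positivity)
  simp only [lp.coeFn_add, Pi.add_apply, lp.coeFn_smul, Pi.smul_apply, smul_eq_mul, lp.coeFn_sum,
    Finset.sum_apply, sum_apply, Finset.mul_sum, ← Finset.sum_add_distrib]
  refine Finset.sum_congr rfl fun j _ => ?_
  -- Exchanging `ζ_j` and `X_j` yields the term with `D_j A_j`; this turns `ζ_j X_j + X_j ζ_j` into
  -- `2 X_j ζ_j` plus a bounded operator.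
  have hc := hasCommutator_conv (symb_sub (fun j => (β : ℂ) * (e j : ℂ) + a j 0) e ρ j) (h1 j)
    (h2 j) U (U₁ j) (hU₁ j) n
  rw [conv_eq_update_add (ha j), hV]
  simp only [map_add, lp.coeFn_add, Pi.add_apply, _root_.add_apply, mul_apply_eq_comp]
  rw [hU₂]
  rw [symb_eq] at hc ⊢
  linear_combination hc

theorem l2Norm_eq {w : UnitAddTorus (Fin d) → ℂ} (hw : MemLp w 2 (torusMeasure d))
    {W : SeqL2 (Fin d → ℤ)} (h : ∀ n, UnitAddTorus.mFourierCoeff w n = W n) : l2Norm w = ‖W‖ := by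
  obtain ⟨W', hW', hn⟩ := exists_coeff hw
  have : W' = W := lp.ext (funext fun n => (hW' n).trans (h n))
  rw [← hn, this]

theorem magnetic_estimate_of_two_le (hd : 2 ≤ d) (s : ℝ) (hs : 3 * (d : ℝ) / 2 - 1 < s)
    (A : Fin d → UnitAddTorus (Fin d) → ℂ) (hA : ∀ j, MemSobolev s (A j))
    (hA_mean : 3 ≤ d → ∀ j, (∫ x, A j x ∂(torusMeasure d)).im = 0) :
    ∃ (C β : ℝ) (e : Fin d → ℝ) (ρ₀ : ℝ), 0 < C ∧ 0 < β ∧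
      ∀ ρ : ℝ, ρ₀ ≤ ρ → ∀ u : UnitAddTorus (Fin d) → ℂ, MemSobolev 2 u →
        (∃ w : UnitAddTorus (Fin d) → ℂ,
          IsMagneticSquare A (fun j => ((β : ℂ) + Complex.I * (ρ : ℂ)) * (e j : ℂ)) u w) ∧
        ∀ w : UnitAddTorus (Fin d) → ℂ,
          IsMagneticSquare A (fun j => ((β : ℂ) + Complex.I * (ρ : ℂ)) * (e j : ℂ)) u w →
            C * (|ρ| * l2Norm u + sobolevNorm 1 u) ≤ l2Norm w := by
  set a : Fin d → (Fin d → ℤ) → ℂ := fun j m => UnitAddTorus.mFourierCoeff (A j) m with ha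
  have hd' : ((d - 1 : ℕ) : ℝ) = (d : ℝ) - 1 := by
    rw [Nat.cast_sub (by omega)]; simp
  have hsum : ∀ j, Summable fun m => (1 + ‖m‖) ^ (d - 1) * ‖a j m‖ := fun j => by
    -- This is where `s > d/2 + (d - 1)` enters.
    have := summable_norm_rpow_mul_of_sobolev (r := ((d - 1 : ℕ) : ℝ)) (by positivity)
      (by rw [hd']; linarith) (hA j).2
    simpa only [Real.rpow_natCast] using this
  have hone : ∀ m : Fin d → ℤ, (1 : ℝ) ≤ 1 + ‖m‖ := fun m => by linarith [norm_nonneg m]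
  have s0 : ∀ j, Summable fun m => ‖a j m‖ := fun j =>
    (hsum j).of_nonneg_of_le (fun _ => norm_nonneg _) fun m =>
      le_mul_of_one_le_left (norm_nonneg _) (one_le_pow₀ (hone m))
  have s1 : ∀ j, Summable fun m => ‖m‖ * ‖a j m‖ := fun j =>
    (hsum j).of_nonneg_of_le (fun _ => by positivity) fun m => by
      refine mul_le_mul_of_nonneg_right ?_ (norm_nonneg _)
      calc ‖m‖ ≤ (1 + ‖m‖) ^ 1 := by simp
        _ ≤ _ := pow_le_pow_right₀ (hone m) (by omega)
  have hmean : 3 ≤ d → ∀ j, (a j 0).im = 0 := fun h j => by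
    rw [← hA_mean h j]
    simp [ha, mFourierCoeff_eq, UnitAddTorus.mFourier_zero]
  obtain ⟨γ, β, C, ρ₀, hβ, hC, H⟩ := exists_parameters_estimate hd hsum hmean
    (∑ j, (conv (fun m => 2 * (Real.pi : ℂ) * (m j : ℂ) * Function.update (a j) 0 0 m) +
      conv (Function.update (a j) 0 0) * conv (Function.update (a j) 0 0)))
  set e : Fin d → ℝ := fun j => (γ j : ℝ) with he
  set b : Fin d → ℂ := fun j => (β : ℂ) * (e j : ℂ) + a j 0 with hb
  have hbγ : (fun j => (β : ℂ) * (γ j : ℂ) + a j 0) = b := by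
    ext j; simp [hb, he]
  rw [hbγ] at H
  set κ := 1 + ∑ j, (‖b j‖ + |e j|) with hκ
  have hκ0 : 0 ≤ κ := by positivity
  refine ⟨1 / ((1 + κ) * C), β, e, max 1 ρ₀, by positivity, hβ, fun ρ hρ u hu => ?_⟩
  have hρ1 : 1 ≤ ρ := (le_max_left _ _).trans hρ
  obtain ⟨U, hU, hUn⟩ := exists_coeff hu.1
  obtain ⟨U₁, U₂, hU₁, hU₂⟩ := exists_symb_mul hu hU b e ρ
  set V : Fin d → SeqL2 (Fin d → ℤ) := fun j => U₁ j + conv (Function.update (a j) 0 0) U with hV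
  have hVn : ∀ j n, V j n = (2 * (Real.pi : ℂ) * (n j : ℂ) +
      ((β : ℂ) + Complex.I * (ρ : ℂ)) * (e j : ℂ)) * U n + conv (a j) U n := fun j n => by
    rw [conv_eq_update_add (s0 j), hV, lp.coeFn_add, Pi.add_apply, hU₁, hb, symb_eq]
    ring
  have hexp := magnetic_square_expand s0 s1 hU₁ hU₂ (V := V) fun j => rfl
  have hiff := fun w => isMagneticSquare_iff
    (fun j => ((β : ℂ) + Complex.I * (ρ : ℂ)) * (e j : ℂ)) (fun j => (hA j).1) s0 hu.1 hU (w := w)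
  have hbound := H ρ ((le_max_right _ _).trans hρ) U U₁ U₂ hU₁ hU₂
  obtain ⟨W, hW⟩ : ∃ W : SeqL2 (Fin d → ℤ), W =
    ∑ j, U₂ j + (2 : ℂ) • ∑ j, conv (Function.update (a j) 0 0) (U₁ j) +
        (∑ j, (conv (fun m => 2 * (Real.pi : ℂ) * (m j : ℂ) * Function.update (a j) 0 0 m) +
          conv (Function.update (a j) 0 0) * conv (Function.update (a j) 0 0))) U := ⟨_, rfl⟩
  rw [← hW] at hbound hexp
  refine ⟨?_, fun w hw => ?_⟩
  · obtain ⟨w, hw, hwW⟩ := exists_fun W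
    exact ⟨w, (hiff w).2 ⟨hw, V, hVn, fun n => (hwW n).trans (hexp n).symm⟩⟩
  · obtain ⟨hwL, V', hV', hw'⟩ := (hiff w).1 hw
    have hVV : V' = V := by
      ext j n
      rw [hV', hVn]
    rw [hVV] at hw'
    have hwn := l2Norm_eq hwL fun n => (hw' n).trans (hexp n)
    have hsob := sobolevNorm_one_le hu hU hρ1 hU₁
    rw [← hκ] at hsob
    rw [hwn, ← hUn, abs_of_nonneg (by linarith), one_div_mul_eq_div,
      div_le_iff₀ (by positivity)]
    have hS : 0 ≤ ∑ j, ‖U₁ j‖ := by positivity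
    have hU0 : 0 ≤ ρ * ‖U‖ := by positivity
    nlinarith [mul_le_mul_of_nonneg_left hbound (by positivity : 0 ≤ 1 + κ)]

/-- Any `β` works, because `|Im ζ| = ρ` already gives `|ζ| ≥ ρ`, and `ζ + X` is bounded below once
`ρ` exceeds `‖X‖`. The mean of `A` may stay in `X`, and the estimate needs no derivative of `A`. -/
theorem magnetic_estimate_one (s : ℝ) (hs : 1 / 2 < s)
    (A : Fin 1 → UnitAddTorus (Fin 1) → ℂ) (hA : ∀ j, MemSobolev s (A j)) :
    ∃ (C β : ℝ) (e : Fin 1 → ℝ) (ρ₀ : ℝ), 0 < C ∧ 0 < β ∧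
      ∀ ρ : ℝ, ρ₀ ≤ ρ → ∀ u : UnitAddTorus (Fin 1) → ℂ, MemSobolev 2 u →
        (1 ≤ s → ∃ w : UnitAddTorus (Fin 1) → ℂ,
          IsMagneticSquare A (fun j => ((β : ℂ) + Complex.I * (ρ : ℂ)) * (e j : ℂ)) u w) ∧
        ∀ w : UnitAddTorus (Fin 1) → ℂ,
          IsMagneticSquare A (fun j => ((β : ℂ) + Complex.I * (ρ : ℂ)) * (e j : ℂ)) u w →
            C * (|ρ| * l2Norm u + sobolevNorm 1 u) ≤ l2Norm w := by
  set a : Fin 1 → (Fin 1 → ℤ) → ℂ := fun j m => UnitAddTorus.mFourierCoeff (A j) m with ha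
  have s0 : ∀ j, Summable fun m => ‖a j m‖ := fun j => by
    simpa using summable_norm_rpow_mul_of_sobolev (r := 0) le_rfl (by simpa using hs) (hA j).2
  set X := conv (a 0) with hX
  set e : Fin 1 → ℝ := fun _ => 1 with he
  set b : Fin 1 → ℂ := fun j => ((1 : ℝ) : ℂ) * (e j : ℂ) + 0 with hb
  refine ⟨1 / 10, 1, e, 2 * ‖X‖ + 2, by norm_num, one_pos, fun ρ hρ u hu => ?_⟩
  have hX0 := norm_nonneg X
  have hρ1 : 1 ≤ ρ := by linarith
  obtain ⟨U, hU, hUn⟩ := exists_coeff hu.1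
  obtain ⟨U₁, U₂, hU₁, hU₂⟩ := exists_symb_mul hu hU b e ρ
  have hsymb : ∀ j n, symb b e ρ j n = 2 * (Real.pi : ℂ) * (n j : ℂ) +
      (((1 : ℝ) : ℂ) + Complex.I * (ρ : ℂ)) * (e j : ℂ) := fun j n => by
    rw [hb, symb_eq 1 e (fun _ => 0), add_zero]
  have hlow : ∀ j n, ρ ≤ ‖symb b e ρ j n‖ := fun j n => by
    refine le_trans ?_ (Complex.abs_im_le_norm _)
    rw [symb_im]
    simp [hb, he, le_abs_self]
  have hiff := fun w => isMagneticSquare_iff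
    (fun j => (((1 : ℝ) : ℂ) + Complex.I * (ρ : ℂ)) * (e j : ℂ)) (fun j => (hA j).1) s0 hu.1 hU
    (w := w)
  simp only [← hsymb] at hiff
  refine ⟨fun hs1 => ?_, fun w hw => ?_⟩
  -- For existence, `ζ X U` must be square summable, though the coefficients of `D A` need not be
  -- summable. The roles are exchanged: `X U` is convolution of `α` with the summable `U`, and `ζ α`
  -- is square summable because `s ≥ 1`.
  · obtain ⟨α, hα⟩ := exists_of_summable (φ := a 0) (by
      obtain ⟨α, hα, -⟩ := exists_coeff (hA 0).1
      exact (summable_norm_sq α).congr fun n => by rw [hα])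
    obtain ⟨K, hK0, hK⟩ := norm_symb_sq_le b e ρ 0
    obtain ⟨α', hα'⟩ := exists_of_summable (φ := fun n => symb b e ρ 0 n * α n) (by
      refine ((hA 0).2.mul_left K).of_nonneg_of_le (fun _ => by positivity) fun n => ?_
      have h1 : 1 + freqSq n ≤ (1 + freqSq n) ^ s := by
        conv_lhs => rw [← Real.rpow_one (1 + freqSq n)]
        exact Real.rpow_le_rpow_of_exponent_le (by linarith [freqSq_nonneg n]) hs1
      rw [norm_mul, mul_pow, hα, ← mul_assoc]
      exact mul_le_mul_of_nonneg_right ((hK n).trans (mul_le_mul_of_nonneg_left h1 hK0))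
        (sq_nonneg _))
    have hUs : Summable fun m => (1 + ‖m‖) * ‖U m‖ := by
      have := summable_norm_rpow_mul_of_sobolev (r := 1) (s := 2) zero_le_one (by norm_num) hu.2
      simpa only [Real.rpow_one, ← hU] using this
    have hUs0 : Summable fun m => ‖U m‖ := hUs.of_nonneg_of_le (fun _ => norm_nonneg _) fun m =>
      le_mul_of_one_le_left (norm_nonneg _) (by linarith [norm_nonneg m])
    have hUs1 : Summable fun m : Fin 1 → ℤ => ‖2 * (Real.pi : ℂ) * (m 0 : ℂ) * U m‖ :=
      (hUs.mul_left (2 * Real.pi)).of_nonneg_of_le (fun _ => norm_nonneg _) fun m => by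
        have h3 := norm_le_pi_norm m 0
        rw [Int.norm_eq_abs] at h3
        have h4 : ‖2 * (Real.pi : ℂ) * (m 0 : ℂ) * U m‖ =
            2 * Real.pi * (|(m 0 : ℝ)| * ‖U m‖) := by
          simp [abs_of_pos Real.pi_pos, mul_assoc]
        rw [h4]
        gcongr
        linarith
    have hcomm : X U = conv U α := by
      have : X = conv α := by rw [hX]; congr 1; ext n; rw [hα]
      rw [this]
      exact conv_apply_comm (by simpa only [hα] using s0 0) hUs0
    have hc := hasCommutator_conv (symb_sub b e ρ 0) hUs0 hUs1 α α' hα'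
    set V : Fin 1 → SeqL2 (Fin 1 → ℤ) := fun _ => U₁ 0 + X U with hV
    obtain ⟨w, hw, hwW⟩ := exists_fun (U₂ 0 + (conv U α' +
      conv (fun m : Fin 1 → ℤ => 2 * (Real.pi : ℂ) * (m 0 : ℂ) * U m) α) + X (V 0))
    refine ⟨w, (hiff w).2 ⟨hw, V, fun j n => ?_, fun n => ?_⟩⟩
    · rw [Subsingleton.elim j 0, hV, lp.coeFn_add, Pi.add_apply, hU₁]
    · rw [hwW, Fin.sum_univ_one]
      simp only [lp.coeFn_add, Pi.add_apply]
      rw [← hc n, hU₂, hV]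
      simp only [lp.coeFn_add, Pi.add_apply, hcomm]
      ring
  · obtain ⟨hwL, V, hV, hw'⟩ := (hiff w).1 hw
    obtain ⟨W, hW, hWn⟩ := exists_coeff hwL
    have hV1 : V 0 = U₁ 0 + X U := lp.ext (funext fun n => by
      rw [hV, lp.coeFn_add, Pi.add_apply, hU₁])
    have hW1 : ∀ n, (W - X (V 0)) n = symb b e ρ 0 n * V 0 n := fun n => by
      rw [lp.coeFn_sub, Pi.sub_apply, hW, hw', Fin.sum_univ_one]
      ring
    have hlow' : ∀ f g : SeqL2 (Fin 1 → ℤ), (∀ n, f n = symb b e ρ 0 n * g n) →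
        ρ * ‖g‖ ≤ ‖f‖ := fun f g hfg => by
      have := norm_le_mul (f := (ρ : ℂ) • g) (g := f) zero_le_one fun n => by
        rw [norm_ofReal_smul_apply, abs_of_nonneg (by linarith), hfg, norm_mul, one_mul]
        exact mul_le_mul_of_nonneg_right (hlow 0 n) (norm_nonneg _)
      rwa [norm_ofReal_smul, one_mul, abs_of_nonneg (by linarith)] at this
    have b1 := hlow' _ _ (hU₁ 0)
    have b2 := hlow' _ _ hW1
    have b3 : ‖U₁ 0‖ ≤ ‖V 0‖ + ‖X‖ * ‖U‖ := by
      have : U₁ 0 = V 0 - X U := by rw [hV1]; abel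
      rw [this]
      exact (norm_sub_le _ _).trans (add_le_add le_rfl (ContinuousLinearMap.le_opNorm _ _))
    have b4 : ‖W - X (V 0)‖ ≤ ‖W‖ + ‖X‖ * ‖V 0‖ :=
      (norm_sub_le _ _).trans (add_le_add le_rfl (ContinuousLinearMap.le_opNorm _ _))
    have hsob := sobolevNorm_one_le hu hU hρ1 hU₁
    rw [Fin.sum_univ_one, Fin.sum_univ_one] at hsob
    have hbe : ‖b 0‖ + |e 0| = 2 := by simp [hb, he]; norm_num
    rw [hbe] at hsob
    rw [← hWn, ← hUn, abs_of_nonneg (by linarith)]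
    have hU0 := norm_nonneg U
    have hV0 := norm_nonneg (V 0)
    -- With these three bounds `ρ‖U‖ + sobolevNorm 1 u ≤ 4ρ‖U‖ + ‖U₁ 0‖ ≤ 8‖W‖ + 2‖W‖`, whence the
    -- constant `1/10`.
    have c1 : ‖V 0‖ ≤ ‖W‖ := by nlinarith
    have c2 : ρ * ‖U‖ ≤ 2 * ‖V 0‖ := by nlinarith
    have c3 : ‖X‖ * ‖U‖ ≤ ‖W‖ := by nlinarith
    linarith

end Main

end

theorem theorem1 (d : ℕ) (hd : 1 ≤ d) (s : ℝ) (hs : 3 * (d : ℝ) / 2 - 1 < s)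
    (A : Fin d → UnitAddTorus (Fin d) → ℂ) (hA : ∀ j, MemSobolev s (A j))
    (hA_mean : 3 ≤ d → ∀ j, (∫ x, A j x ∂(torusMeasure d)).im = 0) :
    ∃ (C β : ℝ) (e : Fin d → ℝ) (ρ₀ : ℝ), 0 < C ∧ 0 < β ∧
      ∀ ρ : ℝ, ρ₀ ≤ ρ → ∀ u : UnitAddTorus (Fin d) → ℂ, MemSobolev 2 u →
        (1 ≤ s → ∃ w : UnitAddTorus (Fin d) → ℂ,
          IsMagneticSquare A (fun j => ((β : ℂ) + Complex.I * (ρ : ℂ)) * (e j : ℂ)) u w) ∧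
        ∀ w : UnitAddTorus (Fin d) → ℂ,
          IsMagneticSquare A (fun j => ((β : ℂ) + Complex.I * (ρ : ℂ)) * (e j : ℂ)) u w →
            C * (|ρ| * l2Norm u + sobolevNorm 1 u) ≤ l2Norm w := by
  rcases hd.eq_or_lt with rfl | hd
  · exact magnetic_estimate_one s (by norm_num at hs ⊢; linarith) A hA
  · obtain ⟨C, β, e, ρ₀, hC, hβ, H⟩ := magnetic_estimate_of_two_le hd s hs A hA hA_mean
    exact ⟨C, β, e, ρ₀, hC, hβ, fun ρ hρ u hu =>
      ⟨fun _ => (H ρ hρ u hu).1, (H ρ hρ u hu).2⟩⟩
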